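/- Let $M$ be a smooth manifold, $n\ge 1$, and let $(M,\omega,H)$ be a multi-Hamiltonian system: $\omega\in\Omega^{n+1}(M)$ is $n$-plectic, i.e. closed and such that $v\mapsto v\lrcorner\,\omega$ is injective on every tangent space, $H\in\Omega^{n-1}(M)$, and $X_H$ is a vector field with $dH=-X_H\lrcorner\,\omega$. Conventions. For vector fields $X_1,\dots,X_k$ and a form $\tau$ let $(X_1\wedge\cdots\wedge X_k)\lrcorner\,\tau=X_k\lrcorner\cdots X_1\lrcorner\,\tau$, extended linearly to all $k$-vector fields $X\in\Gamma(\Lambda^kTM)$, and let $\mathcal L_X\tau=d(X\lrcorner\,\tau)-(-1)^kX\lrcorner\,d\tau$. The Schouten bracket $[\cdot,\cdot]:\Gamma(\Lambda^kTM)\times\Gamma(\Lambda^lTM)\to\Gamma(\Lambda^{k+l-1}TM)$ ($k,l\ge1$) is the linear extension of $$[X_1\wedge\cdots\wedge X_k,\,Y_1\wedge\cdots\wedge Y_l]=\sum_{i,j}(-1)^{i+j}[X_i,Y_j]\wedge X_1\wedge\cdots\widehat{X_i}\cdots\wedge X_k\wedge Y_1\wedge\cdots\widehat{Y_j}\cdots\wedge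 Y_l .$$ With $k$-vector fields in degree $k-1$, a graded Lie bracket is a bilinear bracket, additive in degrees, with $[x,y]=-(-1)^{|x||y|}[y,x]$ and $(-1)^{|x||z|}[x,[y,z]]+(-1)^{|y||x|}[y,[z,x]]+(-1)^{|z||y|}[z,[x,y]]=0$. For $k\ge1$, a form $\alpha\in\Omega^{n-k}(M)$ is Hamiltonian if $d\alpha=-X_\alpha\lrcorner\,\omega$ for some $X_\alpha\in\Gamma(\Lambda^kTM)$ (a Hamiltonian $k$-vector field of $\alpha$); a $k$-vector field $X$ is Hamiltonian if $X\lrcorner\,\omega$ is exact. For Hamiltonian $\alpha\in\Omega^{n-k}(M)$, $\beta\in\Omega^{n-l}(M)$ put $\{\alpha,\beta\}=(-1)^{l+1}X_\beta\lrcorner X_\alpha\lrcorner\,\omega$; an $(n-k)$-form has degree $k-1$ for this bracket. A Hamiltonian form $\alpha$ is a local (resp. global) conserved quantity if $\mathcal L_{X_H}\alpha$ is closed (resp. exact). A Hamiltonian multivector field $X$ is a local (resp. global, strict) continuous symmetry if $\mathcal L_XH$ is closed (resp. exact, zero). Let $\mathcal C_{\rm loc}(X_H)$, $\mathcal C(X_H)$,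 and $\mathcal S_{\rm loc}(H)$, $\mathcal S(H)$, $\mathcal S_{\rm str}(H)$ be the corresponding graded vector spaces; let $\widetilde{\mathcal C}_{\rm loc}(X_H)$, $\widetilde{\mathcal C}(X_H)$ be the quotients by the closed forms, and $\widetilde{\mathcal S}_{\rm loc}(H)$, $\widetilde{\mathcal S}(H)$ the quotients by $\ker\omega=\{\kappa:\kappa\lrcorner\,\omega=0\}$. (An exact $0$-form is zero.) Theorem. (1) The Schouten bracket is a graded Lie bracket on the multivector fields of degree $k\ge1$; the Hamiltonian multivector fields form a graded Lie subalgebra, and $\mathcal S_{\rm loc}(H)$, $\mathcal S(H)$ and $\mathcal S_{\rm str}(H)$ are graded Lie subalgebras of it. (2) $\mathcal C(X_H)$ and $\mathcal C_{\rm loc}(X_H)$ are closed under $\{\cdot,\cdot\}$, whatever Hamiltonian multivector fields are used to compute it, and $\{\cdot,\cdot\}$ and $[\cdot,\cdot]$ descend to graded Lie brackets on $\widetilde{\mathcal C}(X_H)$, $\widetilde{\mathcal C}_{\rm loc}(X_H)$ and on $\widetilde{\mathcal S}(H)$, $\widetilde{\mathcal S}_{\rm loc}(H)$. (3) If $\alpha$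 is a global (resp. local) conserved quantity, then each of its Hamiltonian multivector fields $X_\alpha$ is a global (resp. local) continuous symmetry, and $[\alpha]\mapsto[X_\alpha]$ is a well-defined isomorphism of graded Lie algebras $$(\widetilde{\mathcal C}(X_H),\{\cdot,\cdot\})\to(\widetilde{\mathcal S}(H),[\cdot,\cdot]),\qquad\text{resp.}\qquad(\widetilde{\mathcal C}_{\rm loc}(X_H),\{\cdot,\cdot\})\to(\widetilde{\mathcal S}_{\rm loc}(H),[\cdot,\cdot]).$$ -/

import Mathlib

open scoped Manifold ContDiff Topology Bundle
open Set Filter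

noncomputable section

namespace Multisymplectic

section Analysis

variable {E : Type*} [NormedAddCommGroup E] [NormedSpace ℝ E] [FiniteDimensional ℝ E]
  {G : Type*} [NormedAddCommGroup G] [NormedSpace ℝ G]

theorem contDiffWithinAt_alternating {q : ℕ} {f : G → E [⋀^Fin q]→L[ℝ] ℝ} {s : Set G} {y : G}
    {r : WithTop ℕ∞} (h : ∀ w : Fin q → E, ContDiffWithinAt ℝ r (fun z => f z w) s y) :
    ContDiffWithinAt ℝ r f s y := by
  let b := Module.finBasis ℝ E
  let ev : (E [⋀^Fin q]→L[ℝ] ℝ) →ₗ[ℝ] ((Fin q → Fin (Module.finrank ℝ E)) → ℝ) :=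
    { toFun := fun L σ => L (fun i => b (σ i))
      map_add' := fun _ _ => rfl
      map_smul' := fun _ _ => rfl }
  have hev : LinearMap.ker ev = ⊥ := by
    rw [LinearMap.ker_eq_bot']
    intro L hL
    apply ContinuousAlternatingMap.toAlternatingMap_injective
    refine Module.Basis.ext_alternating b fun v _ => ?_
    exact congrFun hL v
  obtain ⟨g, hg⟩ := ev.exists_leftInverse_of_injective hev
  have hfg : f = fun z => (LinearMap.toContinuousLinearMap g) (ev (f z)) := by
    funext z
    exact (LinearMap.congr_fun hg (f z)).symm
  rw [hfg]
  refine (LinearMap.toContinuousLinearMap g).contDiff.contDiffAt.comp_contDiffWithinAt y ?_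
  rw [contDiffWithinAt_pi]
  exact fun σ => h _

theorem contDiffWithinAt_alternating_apply {q : ℕ} {f : G → E [⋀^Fin q]→L[ℝ] ℝ}
    {u : Fin q → G → E} {s : Set G} {y : G} {r : WithTop ℕ∞} (hf : ContDiffWithinAt ℝ r f s y)
    (hu : ∀ i, ContDiffWithinAt ℝ r (u i) s y) :
    ContDiffWithinAt ℝ r (fun z => f z (fun i => u i z)) s y := by
  let b := Module.finBasis ℝ E
  have key : ∀ z, f z (fun i => u i z) =
      ∑ σ : Fin q → Fin (Module.finrank ℝ E),
        (∏ i, b.repr (u i z) (σ i)) * f z (fun i => b (σ i)) := by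
    intro z
    have h1 : (fun i => u i z) = fun i => ∑ j, b.repr (u i z) j • b j := by
      funext i; exact (b.sum_repr _).symm
    conv_lhs => rw [h1]
    have := (f z).toMultilinearMap.map_sum (fun i j => b.repr (u i z) j • b j)
    refine this.trans (Finset.sum_congr rfl fun σ _ => ?_)
    exact (f z).toMultilinearMap.map_smul_univ _ _
  simp_rw [key]
  refine ContDiffWithinAt.sum fun σ _ => ContDiffWithinAt.mul (contDiffWithinAt_prod fun i _ => ?_) ?_
  · have : ContDiff ℝ r (LinearMap.toContinuousLinearMap (b.coord (σ i))) :=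
      (LinearMap.toContinuousLinearMap (b.coord (σ i))).contDiff
    exact this.contDiffAt.comp_contDiffWithinAt y (hu i)
  · let A : (E [⋀^Fin q]→L[ℝ] ℝ) →L[ℝ] ℝ :=
      ContinuousAlternatingMap.apply ℝ E ℝ (fun i => b (σ i))
    exact A.contDiff.contDiffAt.comp_contDiffWithinAt y hf

end Analysis

variable {E : Type*} [NormedAddCommGroup E] [NormedSpace ℝ E] [FiniteDimensional ℝ E]
  {M : Type*} [TopologicalSpace M] [ChartedSpace E M] [IsManifold 𝓘(ℝ, E) ∞ M]


variable (E M) in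
/-- Smooth vector fields on `M`. -/
abbrev VecField := Cₛ^∞⟮𝓘(ℝ, E); E, (TangentSpace 𝓘(ℝ, E) : M → Type _)⟯

variable (E M) in
/-- Smooth differential `p`-forms on `M`: smooth sections of the bundle of alternating `p`-linear
forms on the tangent bundle. -/
abbrev Form (p : ℕ) : Type _ :=
  Cₛ^∞⟮𝓘(ℝ, E); E [⋀^Fin p]→L[ℝ] ℝ,
    (fun x : M => TangentSpace 𝓘(ℝ, E) x [⋀^Fin p]→L[ℝ] Bundle.Trivial M ℝ x)⟯

/-- The expression of a `p`-form in the chart at `x₀`: its pullback under the inverse chart. -/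
def chartRep {p : ℕ} (x₀ : M) (τ : ∀ x : M, TangentSpace 𝓘(ℝ, E) x [⋀^Fin p]→L[ℝ] ℝ) (y : E) :
    E [⋀^Fin p]→L[ℝ] ℝ :=
  (τ ((extChartAt 𝓘(ℝ, E) x₀).symm y)).compContinuousLinearMap
    (mfderiv 𝓘(ℝ, E) 𝓘(ℝ, E) (extChartAt 𝓘(ℝ, E) x₀).symm y :)

/-- The exterior derivative at `x`: take it in the chart at `x` and pull it back to `M`. It is
computed by every other chart as well (`Form.chartRep_extDerivAt`). -/
def extDerivAt {p : ℕ} (τ : ∀ x : M, TangentSpace 𝓘(ℝ, E) x [⋀^Fin p]→L[ℝ] ℝ) (x : M) :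
    TangentSpace 𝓘(ℝ, E) x [⋀^Fin (p + 1)]→L[ℝ] ℝ :=
  (extDeriv (chartRep x τ) (extChartAt 𝓘(ℝ, E) x x)).compContinuousLinearMap
    (mfderiv 𝓘(ℝ, E) 𝓘(ℝ, E) (extChartAt 𝓘(ℝ, E) x) x :)


theorem trivialization_eq_chartRep {p : ℕ} (x₀ : M)
    (τ : ∀ x : M, TangentSpace 𝓘(ℝ, E) x [⋀^Fin p]→L[ℝ] Bundle.Trivial M ℝ x)
    {x : M} (hx : x ∈ (extChartAt 𝓘(ℝ, E) x₀).source) :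
    (trivializationAt (E [⋀^Fin p]→L[ℝ] ℝ)
      (fun x : M => TangentSpace 𝓘(ℝ, E) x [⋀^Fin p]→L[ℝ] Bundle.Trivial M ℝ x) x₀ ⟨x, τ x⟩).2 =
      chartRep x₀ τ (extChartAt 𝓘(ℝ, E) x₀ x) := by
  have hx' : x ∈ (chartAt E x₀).source := by simpa using hx
  have h1 := TangentBundle.symmL_trivializationAt (I := 𝓘(ℝ, E)) hx'
  rw [ModelWithCorners.Boundaryless.range_eq_univ, mfderivWithin_univ] at h1
  rw [FiberBundle.trivializationAt_continuousAlternatingMap_apply]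
  ext v
  have h2 : (extChartAt 𝓘(ℝ, E) x₀).symm (extChartAt 𝓘(ℝ, E) x₀ x) = x :=
    (extChartAt 𝓘(ℝ, E) x₀).left_inv hx
  have key : ∀ (x' : M) (h : x' = x) (D : E →L[ℝ] TangentSpace 𝓘(ℝ, E) x'),
      (∀ w, (D w : E) = ((trivializationAt E (TangentSpace 𝓘(ℝ, E)) x₀).symmL ℝ x w : E)) →
      (ContinuousAlternatingMap.inCoordinates E ℝ x₀ x x₀ x (τ x)) v =
        (τ x').compContinuousLinearMap D v := by
    rintro x' rfl D hD
    simp only [ContinuousAlternatingMap.inCoordinates]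
    have : D = (trivializationAt E (TangentSpace 𝓘(ℝ, E)) x₀).symmL ℝ x' := by
      ext w; exact hD w
    rw [this]
    simp
  refine key _ h2 _ fun w => ?_
  rw [h1]
  rfl

theorem chartRep_transition {p : ℕ}
    (τ : ∀ x : M, TangentSpace 𝓘(ℝ, E) x [⋀^Fin p]→L[ℝ] ℝ) (x₀ x₁ : M) {y : E}
    (hy : y ∈ (extChartAt 𝓘(ℝ, E) x₀).target)
    (hy' : (extChartAt 𝓘(ℝ, E) x₀).symm y ∈ (extChartAt 𝓘(ℝ, E) x₁).source) :
    chartRep x₀ τ y = (chartRep x₁ τ (extChartAt 𝓘(ℝ, E) x₁ ((extChartAt 𝓘(ℝ, E) x₀).symm y))).compContinuousLinearMap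
      (fderiv ℝ (extChartAt 𝓘(ℝ, E) x₁ ∘ (extChartAt 𝓘(ℝ, E) x₀).symm) y) := by
  have hT : ContMDiffAt 𝓘(ℝ, E) 𝓘(ℝ, E) ∞ (extChartAt 𝓘(ℝ, E) x₁ ∘ (extChartAt 𝓘(ℝ, E) x₀).symm) y := by
    have h1 := contMDiffOn_extChartAt_symm (I := 𝓘(ℝ, E)) (n := ∞) x₀
    have h1 := h1.contMDiffAt ((isOpen_extChartAt_target (I := 𝓘(ℝ, E)) x₀).mem_nhds hy)
    exact (contMDiffAt_extChartAt' (by simpa using hy')).comp y h1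
  have hmd : MDifferentiableAt 𝓘(ℝ, E) 𝓘(ℝ, E)
      (extChartAt 𝓘(ℝ, E) x₁ ∘ (extChartAt 𝓘(ℝ, E) x₀).symm) y := hT.mdifferentiableAt (by simp)
  set T := extChartAt 𝓘(ℝ, E) x₁ ∘ (extChartAt 𝓘(ℝ, E) x₀).symm with hTdef
  have hTy : T y ∈ (extChartAt 𝓘(ℝ, E) x₁).target := (extChartAt 𝓘(ℝ, E) x₁).map_source hy'
  have hs : MDifferentiableAt 𝓘(ℝ, E) 𝓘(ℝ, E) (extChartAt 𝓘(ℝ, E) x₁).symm (T y) := by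
    have h1 := contMDiffOn_extChartAt_symm (I := 𝓘(ℝ, E)) (n := ∞) x₁
    exact (h1.contMDiffAt ((isOpen_extChartAt_target (I := 𝓘(ℝ, E)) x₁).mem_nhds hTy)).mdifferentiableAt
      (by simp)
  have heq : (extChartAt 𝓘(ℝ, E) x₀).symm =ᶠ[𝓝 y] (extChartAt 𝓘(ℝ, E) x₁).symm ∘ T := by
    have hc : ContinuousAt (extChartAt 𝓘(ℝ, E) x₀).symm y := continuousAt_extChartAt_symm'' hy
    have := hc.preimage_mem_nhds ((isOpen_extChartAt_source (I := 𝓘(ℝ, E)) x₁).mem_nhds hy')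
    filter_upwards [this] with z hz
    exact ((extChartAt 𝓘(ℝ, E) x₁).left_inv hz).symm
  have hD : mfderiv 𝓘(ℝ, E) 𝓘(ℝ, E) (extChartAt 𝓘(ℝ, E) x₀).symm y =
      mfderiv 𝓘(ℝ, E) 𝓘(ℝ, E) ((extChartAt 𝓘(ℝ, E) x₁).symm ∘ T) y := heq.mfderiv_eq
  rw [mfderiv_comp y hs hmd, mfderiv_eq_fderiv] at hD
  have hpt := heq.eq_of_nhds
  ext v
  have key : ∀ (a b : M) (h : a = b) (D : E →L[ℝ] TangentSpace 𝓘(ℝ, E) a)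
      (D' : E →L[ℝ] TangentSpace 𝓘(ℝ, E) b), (∀ w, (D w : E) = (D' w : E)) →
      (τ a).compContinuousLinearMap D v = (τ b).compContinuousLinearMap D' v := by
    rintro a b rfl D D' hDD
    have : D = D' := by ext w; exact hDD w
    rw [this]
  exact key _ _ hpt
    (mfderiv 𝓘(ℝ, E) 𝓘(ℝ, E) (extChartAt 𝓘(ℝ, E) x₀).symm y)
    (ContinuousLinearMap.comp (mfderiv 𝓘(ℝ, E) 𝓘(ℝ, E) (extChartAt 𝓘(ℝ, E) x₁).symm (T y))
      (fderiv ℝ T y)) (fun w => DFunLike.congr_fun hD w)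

theorem contDiffAt_transition (x₀ x₁ : M) {y : E}
    (hy : y ∈ (extChartAt 𝓘(ℝ, E) x₀).target)
    (hy' : (extChartAt 𝓘(ℝ, E) x₀).symm y ∈ (extChartAt 𝓘(ℝ, E) x₁).source) :
    ContDiffAt ℝ ∞ (extChartAt 𝓘(ℝ, E) x₁ ∘ (extChartAt 𝓘(ℝ, E) x₀).symm) y := by
  rw [← contMDiffAt_iff_contDiffAt]
  have h1 := contMDiffOn_extChartAt_symm (I := 𝓘(ℝ, E)) (n := ∞) x₀
  have h1 := h1.contMDiffAt ((isOpen_extChartAt_target (I := 𝓘(ℝ, E)) x₀).mem_nhds hy)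
  exact (contMDiffAt_extChartAt' (by simpa using hy')).comp y h1

theorem eventually_mem_source (x₀ x₁ : M) {y : E}
    (hy : y ∈ (extChartAt 𝓘(ℝ, E) x₀).target)
    (hy' : (extChartAt 𝓘(ℝ, E) x₀).symm y ∈ (extChartAt 𝓘(ℝ, E) x₁).source) :
    ∀ᶠ z in 𝓝 y, z ∈ (extChartAt 𝓘(ℝ, E) x₀).target ∧
      (extChartAt 𝓘(ℝ, E) x₀).symm z ∈ (extChartAt 𝓘(ℝ, E) x₁).source := by
  have hc : ContinuousAt (extChartAt 𝓘(ℝ, E) x₀).symm y := continuousAt_extChartAt_symm'' hy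
  have h1 := hc.preimage_mem_nhds ((isOpen_extChartAt_source (I := 𝓘(ℝ, E)) x₁).mem_nhds hy')
  filter_upwards [h1, (isOpen_extChartAt_target (I := 𝓘(ℝ, E)) x₀).mem_nhds hy] with z hz hz'
  exact ⟨hz', hz⟩

theorem contDiffAt_comp_fderiv {p : ℕ} {F : E → E [⋀^Fin p]→L[ℝ] ℝ} {T : E → E} {y : E}
    (hF : ContDiffAt ℝ ∞ F (T y)) (hT : ContDiffAt ℝ ∞ T y) :
    ContDiffAt ℝ ∞ (fun z => (F (T z)).compContinuousLinearMap (fderiv ℝ T z)) y := by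
  refine contDiffWithinAt_alternating (s := univ) fun w => ?_
  refine contDiffWithinAt_alternating_apply (f := fun z => F (T z))
    (u := fun i z => fderiv ℝ T z (w i)) (hF.comp y hT) fun i => ?_
  exact (hT.fderiv_right (m := ∞) (by simp)).clm_apply contDiffAt_const

theorem contMDiff_iff_chartRep {p : ℕ}
    (τ : ∀ x : M, TangentSpace 𝓘(ℝ, E) x [⋀^Fin p]→L[ℝ] Bundle.Trivial M ℝ x) :
    ContMDiff 𝓘(ℝ, E) (𝓘(ℝ, E).prod 𝓘(ℝ, E [⋀^Fin p]→L[ℝ] ℝ)) ∞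
      (fun x => Bundle.TotalSpace.mk' (E [⋀^Fin p]→L[ℝ] ℝ)
        (E := fun x : M => TangentSpace 𝓘(ℝ, E) x [⋀^Fin p]→L[ℝ] Bundle.Trivial M ℝ x)
        x (τ x)) ↔
      ∀ x₀ : M, ContDiffAt ℝ ∞ (chartRep x₀ τ) (extChartAt 𝓘(ℝ, E) x₀ x₀) := by
  refine forall_congr' fun x₀ => ?_
  rw [Bundle.contMDiffAt_section]
  have hsrc := extChartAt_source_mem_nhds (I := 𝓘(ℝ, E)) x₀
  have h1 : (fun x => (trivializationAt (E [⋀^Fin p]→L[ℝ] ℝ)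
      (fun x : M => TangentSpace 𝓘(ℝ, E) x [⋀^Fin p]→L[ℝ] Bundle.Trivial M ℝ x) x₀
        ⟨x, τ x⟩).2) =ᶠ[𝓝 x₀] (chartRep x₀ τ) ∘ extChartAt 𝓘(ℝ, E) x₀ := by
    filter_upwards [hsrc] with x hx
    exact trivialization_eq_chartRep x₀ τ hx
  rw [h1.contMDiffAt_iff]
  constructor
  · intro h
    rw [← contMDiffAt_iff_contDiffAt]
    have h2 := contMDiffOn_extChartAt_symm (I := 𝓘(ℝ, E)) (n := ∞) x₀
    have h2 := h2.contMDiffAt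
      ((isOpen_extChartAt_target (I := 𝓘(ℝ, E)) x₀).mem_nhds (mem_extChartAt_target x₀))
    have h3 : ContMDiffAt 𝓘(ℝ, E) 𝓘(ℝ, E [⋀^Fin p]→L[ℝ] ℝ) ∞
        (chartRep x₀ τ ∘ extChartAt 𝓘(ℝ, E) x₀)
        ((extChartAt 𝓘(ℝ, E) x₀).symm (extChartAt 𝓘(ℝ, E) x₀ x₀)) := by
      rwa [extChartAt_to_inv]
    refine (h3.comp _ h2).congr_of_eventuallyEq ?_
    filter_upwards [(isOpen_extChartAt_target (I := 𝓘(ℝ, E)) x₀).mem_nhds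
      (mem_extChartAt_target x₀)] with y hy
    simp only [Function.comp_apply]
    rw [(extChartAt 𝓘(ℝ, E) x₀).right_inv hy]
  · intro h
    exact h.contMDiffAt.comp x₀ contMDiffAt_extChartAt

theorem chartRep_extDerivAt_self {p : ℕ}
    (τ : ∀ x : M, TangentSpace 𝓘(ℝ, E) x [⋀^Fin p]→L[ℝ] ℝ) (x₁ : M) :
    chartRep x₁ (extDerivAt τ) (extChartAt 𝓘(ℝ, E) x₁ x₁) =
      extDeriv (chartRep x₁ τ) (extChartAt 𝓘(ℝ, E) x₁ x₁) := by
  have h1 := mfderiv_extChartAt_comp_mfderivWithin_extChartAt_symm (I := 𝓘(ℝ, E))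
    (mem_extChartAt_target x₁)
  rw [ModelWithCorners.Boundaryless.range_eq_univ, mfderivWithin_univ] at h1
  ext v
  have key : ∀ (a : M) (h : a = x₁) (D : E →L[ℝ] TangentSpace 𝓘(ℝ, E) a),
      (∀ w, (mfderiv 𝓘(ℝ, E) 𝓘(ℝ, E) (extChartAt 𝓘(ℝ, E) x₁) a (D w) : E) = w) →
      (extDerivAt τ a).compContinuousLinearMap D v =
        extDeriv (chartRep x₁ τ) (extChartAt 𝓘(ℝ, E) x₁ x₁) v := by
    rintro a rfl D hD
    simp only [extDerivAt]
    change extDeriv (chartRep a τ) (extChartAt 𝓘(ℝ, E) a a)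
      (fun i => mfderiv 𝓘(ℝ, E) 𝓘(ℝ, E) (extChartAt 𝓘(ℝ, E) a) a (D (v i))) = _
    congr 1
    funext i
    exact hD (v i)
  exact key _ (extChartAt_to_inv x₁)
    (mfderiv 𝓘(ℝ, E) 𝓘(ℝ, E) (extChartAt 𝓘(ℝ, E) x₁).symm (extChartAt 𝓘(ℝ, E) x₁ x₁))
    (fun w => DFunLike.congr_fun h1 w)

namespace Form

theorem contDiffAt_chartRep {p : ℕ} (τ : Form E M p) (x₀ : M) {y : E}
    (hy : y ∈ (extChartAt 𝓘(ℝ, E) x₀).target) : ContDiffAt ℝ ∞ (chartRep x₀ τ) y := by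
  set x₁ := (extChartAt 𝓘(ℝ, E) x₀).symm y with hx₁
  have hy' : (extChartAt 𝓘(ℝ, E) x₀).symm y ∈ (extChartAt 𝓘(ℝ, E) x₁).source :=
    mem_extChartAt_source x₁
  have hT := contDiffAt_transition x₀ x₁ hy hy'
  have h1 := (contMDiff_iff_chartRep τ).1 τ.contMDiff x₁
  refine (contDiffAt_comp_fderiv (T := extChartAt 𝓘(ℝ, E) x₁ ∘ (extChartAt 𝓘(ℝ, E) x₀).symm)
    h1 hT).congr_of_eventuallyEq ?_
  filter_upwards [eventually_mem_source x₀ x₁ hy hy'] with z hz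
  exact chartRep_transition τ x₀ x₁ hz.1 hz.2

theorem chartRep_extDerivAt {p : ℕ} (τ : Form E M p) (x₀ : M) {y : E}
    (hy : y ∈ (extChartAt 𝓘(ℝ, E) x₀).target) :
    chartRep x₀ (extDerivAt τ) y = extDeriv (chartRep x₀ τ) y := by
  set x₁ := (extChartAt 𝓘(ℝ, E) x₀).symm y with hx₁
  have hy' : (extChartAt 𝓘(ℝ, E) x₀).symm y ∈ (extChartAt 𝓘(ℝ, E) x₁).source :=
    mem_extChartAt_source x₁
  have hT := contDiffAt_transition x₀ x₁ hy hy'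
  have h1 := (contMDiff_iff_chartRep τ).1 τ.contMDiff x₁
  have heq : chartRep x₀ τ =ᶠ[𝓝 y] fun z =>
      (chartRep x₁ τ ((extChartAt 𝓘(ℝ, E) x₁ ∘ (extChartAt 𝓘(ℝ, E) x₀).symm) z)).compContinuousLinearMap
      (fderiv ℝ (extChartAt 𝓘(ℝ, E) x₁ ∘ (extChartAt 𝓘(ℝ, E) x₀).symm) z) := by
    filter_upwards [eventually_mem_source x₀ x₁ hy hy'] with z hz
    exact chartRep_transition τ x₀ x₁ hz.1 hz.2
  rw [heq.extDeriv_eq]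
  have hd : DifferentiableAt ℝ (chartRep x₁ τ)
      ((extChartAt 𝓘(ℝ, E) x₁ ∘ (extChartAt 𝓘(ℝ, E) x₀).symm) y) := h1.differentiableAt (by simp)
  refine Eq.trans ?_ (extDeriv_pullback hd hT (by
    rw [minSmoothness_of_isRCLikeNormedField]; exact WithTop.coe_le_coe.2 le_top)).symm
  rw [chartRep_transition _ x₀ x₁ hy hy', ← hx₁, chartRep_extDerivAt_self]
  rfl

theorem contMDiff_extDerivAt {p : ℕ} (τ : Form E M p) :
    ContMDiff 𝓘(ℝ, E) (𝓘(ℝ, E).prod 𝓘(ℝ, E [⋀^Fin (p + 1)]→L[ℝ] ℝ)) ∞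
      (fun x => Bundle.TotalSpace.mk' (E [⋀^Fin (p + 1)]→L[ℝ] ℝ)
        (E := fun x : M => TangentSpace 𝓘(ℝ, E) x [⋀^Fin (p + 1)]→L[ℝ] Bundle.Trivial M ℝ x)
        x (extDerivAt τ x)) := by
  rw [contMDiff_iff_chartRep]
  intro x₀
  have h := τ.contDiffAt_chartRep x₀ (mem_extChartAt_target x₀)
  have h2 : ContDiffAt ℝ ∞ (extDeriv (chartRep x₀ τ)) (extChartAt 𝓘(ℝ, E) x₀ x₀) := by
    let A : (E →L[ℝ] E [⋀^Fin p]→L[ℝ] ℝ) →L[ℝ] E [⋀^Fin (p + 1)]→L[ℝ] ℝ :=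
      ContinuousAlternatingMap.alternatizeUncurryFinCLM ℝ E ℝ
    have h3 : extDeriv (chartRep x₀ τ) = fun y => A (fderiv ℝ (chartRep x₀ τ) y) := rfl
    rw [h3]
    exact A.contDiff.contDiffAt.comp _ (h.fderiv_right (m := ∞) (by simp))
  refine h2.congr_of_eventuallyEq ?_
  filter_upwards [(isOpen_extChartAt_target (I := 𝓘(ℝ, E)) x₀).mem_nhds
      (mem_extChartAt_target x₀)] with y hy
  exact τ.chartRep_extDerivAt x₀ hy

/-- The exterior derivative `d : Ωᵖ(M) → Ωᵖ⁺¹(M)`. -/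
def d {p : ℕ} : Form E M p →ₗ[ℝ] Form E M (p + 1) where
  toFun τ := ⟨fun x => extDerivAt τ x, τ.contMDiff_extDerivAt⟩
  map_add' τ σ := by
    ext x : 1
    have h : chartRep x ⇑(τ + σ) = chartRep x τ + chartRep x σ := rfl
    have h1 := (τ.contDiffAt_chartRep x (mem_extChartAt_target x)).differentiableAt (by simp)
    have h2 := (σ.contDiffAt_chartRep x (mem_extChartAt_target x)).differentiableAt (by simp)
    change extDerivAt _ x = extDerivAt _ x + extDerivAt _ x
    simp only [extDerivAt]
    rw [h, extDeriv_add h1 h2]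
    rfl
  map_smul' c τ := by
    ext x : 1
    have h : chartRep x ⇑(c • τ) = c • chartRep x τ := rfl
    change extDerivAt _ x = c • extDerivAt _ x
    simp only [extDerivAt]
    rw [h, extDeriv_smul]
    rfl

end Form


variable (E M) in
/-- The space of all differential forms, `⨁ p, Ωᵖ(M)`; the product over `p` is the direct sum, as
`Ωᵖ(M) = 0` for `p > dim M`. -/
def Forms : Type _ := ∀ p : ℕ, Form E M p

namespace Forms

instance : AddCommGroup (Forms E M) := inferInstanceAs (AddCommGroup (∀ p : ℕ, Form E M p))

instance : Module ℝ (Forms E M) := inferInstanceAs (Module ℝ (∀ p : ℕ, Form E M p))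

/-- A `p`-form, as an element of the space of all forms. -/
def of {p : ℕ} (τ : Form E M p) : Forms E M := Pi.single p τ

@[simp]
theorem zero_apply (p : ℕ) : (0 : Forms E M) p = 0 := rfl

@[simp]
theorem add_apply (τ σ : Forms E M) (p : ℕ) : (τ + σ) p = τ p + σ p := rfl

@[simp]
theorem smul_apply (c : ℝ) (τ : Forms E M) (p : ℕ) : (c • τ) p = c • τ p := rfl

/-- The exterior derivative on the space of all forms; in particular its range consists of the
exact forms, and `0` is the only exact form of degree `0`. -/
def d : Forms E M →ₗ[ℝ] Forms E M where
  toFun τ := fun p => match p with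
    | 0 => 0
    | p + 1 => Form.d (τ p)
  map_add' τ σ := by
    funext p
    cases p with
    | zero => exact (add_zero 0).symm
    | succ p => exact map_add Form.d (τ p) (σ p)
  map_smul' c τ := by
    funext p
    cases p with
    | zero => exact (smul_zero (A := Form E M 0) c).symm
    | succ p => exact map_smul Form.d c (τ p)

end Forms

section Pointwise

variable {V : Type*} [AddCommGroup V] [Module ℝ V] [TopologicalSpace V] [IsTopologicalAddGroup V]
  [ContinuousSMul ℝ V] [T2Space V] [FiniteDimensional ℝ V]

theorem continuous_alternating {q : ℕ} (L : V [⋀^Fin q]→ₗ[ℝ] ℝ) : Continuous L := by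
  let b := Module.finBasis ℝ V
  have key : ∀ w, L w = ∑ σ : Fin q → Fin (Module.finrank ℝ V),
      (∏ i, b.coord (σ i) (w i)) * L (fun i => b (σ i)) := by
    intro w
    have h1 : w = fun i => ∑ j, b.coord j (w i) • b j := by
      funext i; exact (b.sum_repr _).symm
    conv_lhs => rw [h1]
    refine (L.toMultilinearMap.map_sum (fun i j => b.coord j (w i) • b j)).trans
      (Finset.sum_congr rfl fun σ _ => ?_)
    exact L.toMultilinearMap.map_smul_univ _ _
  have : (L : (Fin q → V) → ℝ) = _ := funext key
  rw [this]
  refine continuous_finsetSum _ fun σ _ => (continuous_finsetProd _ fun i _ => ?_).mul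
    continuous_const
  exact (b.coord (σ i)).continuous_of_finiteDimensional.comp (continuous_apply i)

/-- The pairing of the exterior algebra of `V` with a family of alternating forms on `V`, with
`⟨v₁ ∧ ⋯ ∧ v_p, τ⟩ = τ_p(v₁, …, v_p)`. -/
def pairing (τ : ∀ p, V [⋀^Fin p]→L[ℝ] ℝ) : ExteriorAlgebra ℝ V →ₗ[ℝ] ℝ :=
  ExteriorAlgebra.liftAlternating fun p => (τ p).toAlternatingMap

/-- The component of degree `q` of the contraction `X ⌟ τ` on a vector space `V`, namely
`w₁, …, w_q ↦ ⟨X ∧ w₁ ∧ ⋯ ∧ w_q, τ⟩`. -/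
def contractAt (X : ExteriorAlgebra ℝ V) (τ : ∀ p, V [⋀^Fin p]→L[ℝ] ℝ) (q : ℕ) :
    V [⋀^Fin q]→L[ℝ] ℝ :=
  let L : V [⋀^Fin q]→ₗ[ℝ] ℝ :=
    (pairing τ ∘ₗ LinearMap.mulLeft ℝ X).compAlternatingMap (ExteriorAlgebra.ιMulti ℝ q)
  { L with cont := continuous_alternating L }

theorem contractAt_apply (X : ExteriorAlgebra ℝ V) (τ : ∀ p, V [⋀^Fin p]→L[ℝ] ℝ) (q : ℕ)
    (w : Fin q → V) : contractAt X τ q w = pairing τ (X * ExteriorAlgebra.ιMulti ℝ q w) := rfl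

theorem contractAt_ιMulti {k : ℕ} (v : Fin k → V) (τ : ∀ p, V [⋀^Fin p]→L[ℝ] ℝ) (q : ℕ)
    (w : Fin q → V) :
    contractAt (ExteriorAlgebra.ιMulti ℝ k v) τ q w = τ (k + q) (Fin.append v w) := by
  rw [contractAt_apply, ExteriorAlgebra.ιMulti_mul_ιMulti, pairing,
    ExteriorAlgebra.liftAlternating_apply_ιMulti]
  rfl

theorem contractAt_add_left (X Y : ExteriorAlgebra ℝ V) (τ : ∀ p, V [⋀^Fin p]→L[ℝ] ℝ) (q : ℕ) :
    contractAt (X + Y) τ q = contractAt X τ q + contractAt Y τ q := by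
  ext w
  simp [contractAt_apply, add_mul]

theorem contractAt_smul_left (c : ℝ) (X : ExteriorAlgebra ℝ V) (τ : ∀ p, V [⋀^Fin p]→L[ℝ] ℝ)
    (q : ℕ) : contractAt (c • X) τ q = c • contractAt X τ q := by
  ext w
  simp [contractAt_apply]

theorem contractAt_add_right (X : ExteriorAlgebra ℝ V) (τ σ : ∀ p, V [⋀^Fin p]→L[ℝ] ℝ) (q : ℕ) :
    contractAt X (fun p => τ p + σ p) q = contractAt X τ q + contractAt X σ q := by
  ext w
  have : pairing (fun p => τ p + σ p) = pairing τ + pairing σ :=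
    map_add (ExteriorAlgebra.liftAlternating (R := ℝ) (M := V) (N := ℝ))
      (fun p => (τ p).toAlternatingMap) (fun p => (σ p).toAlternatingMap)
  simp [contractAt_apply, this]

theorem contractAt_smul_right (c : ℝ) (X : ExteriorAlgebra ℝ V) (τ : ∀ p, V [⋀^Fin p]→L[ℝ] ℝ)
    (q : ℕ) : contractAt X (fun p => c • τ p) q = c • contractAt X τ q := by
  ext w
  have : pairing (fun p => c • τ p) = c • pairing τ :=
    map_smul (ExteriorAlgebra.liftAlternating (R := ℝ) (M := V) (N := ℝ)) c
      (fun p => (τ p).toAlternatingMap)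
  simp [contractAt_apply, this]

end Pointwise

variable (E M) in
/-- Sections, not necessarily smooth or homogeneous, of the exterior bundle `Λ(TM)`. -/
def MVSection : Type _ := ∀ x : M, ExteriorAlgebra ℝ (TangentSpace 𝓘(ℝ, E) x)

instance : AddCommGroup (MVSection E M) :=
  inferInstanceAs (AddCommGroup (∀ x : M, ExteriorAlgebra ℝ (TangentSpace 𝓘(ℝ, E) x)))

instance : Module ℝ (MVSection E M) :=
  inferInstanceAs (Module ℝ (∀ x : M, ExteriorAlgebra ℝ (TangentSpace 𝓘(ℝ, E) x)))

@[simp]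
theorem MVSection.zero_apply (x : M) : (0 : MVSection E M) x = 0 := rfl

@[simp]
theorem MVSection.add_apply (X Y : MVSection E M) (x : M) : (X + Y) x = X x + Y x := rfl

@[simp]
theorem MVSection.smul_apply (c : ℝ) (X : MVSection E M) (x : M) : (c • X) x = c • X x := rfl

/-- The multivector field `V₁ ∧ ⋯ ∧ V_k`. -/
def wedge {k : ℕ} (V : Fin k → VecField E M) : MVSection E M :=
  fun x => ExteriorAlgebra.ιMulti ℝ k fun i => V i x

variable (E M) in
/-- The smooth `(j+1)`-vector fields on `M`, that is, the smooth sections of `Λʲ⁺¹(TM)`: locally they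
are finite sums of wedges of `j + 1` smooth vector fields. Here `j` is the degree of the field in
the graded Lie algebra of multivector fields. -/
def MultiVec (j : ℕ) : Submodule ℝ (MVSection E M) where
  carrier := {X | ∀ x₀ : M, ∃ l : List (Fin (j + 1) → VecField E M),
    ∀ᶠ x in 𝓝 x₀, X x = (l.map fun V => wedge V x).sum}
  zero_mem' := fun _ => ⟨[], by simp⟩
  add_mem' := by
    intro X Y hX hY x₀
    obtain ⟨l, hl⟩ := hX x₀
    obtain ⟨m, hm⟩ := hY x₀
    refine ⟨l ++ m, ?_⟩
    filter_upwards [hl, hm] with x h1 h2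
    simp [h1, h2]
  smul_mem' := by
    intro c X hX x₀
    obtain ⟨l, hl⟩ := hX x₀
    refine ⟨l.map fun V => Function.update V 0 (c • V 0), ?_⟩
    filter_upwards [hl] with x h1
    have h2 : ∀ V : Fin (j + 1) → VecField E M,
        wedge (Function.update V 0 (c • V 0)) x = c • wedge V x := by
      intro V
      have h3 : (fun i => (Function.update V 0 (c • V 0) : Fin (j + 1) → VecField E M) i x) =
          Function.update (fun i => V i x) 0 (c • V 0 x) := by
        funext i
        by_cases hi : i = 0
        · subst hi; simp
        · simp [hi]
      rw [wedge, h3, AlternatingMap.map_update_smul, wedge, Function.update_eq_self]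
    rw [MVSection.smul_apply, h1, List.smul_sum, List.map_map, List.map_map]
    congr 1
    exact List.map_congr_left fun V _ => (h2 V).symm

instance (x : M) : FiniteDimensional ℝ (TangentSpace 𝓘(ℝ, E) x) :=
  inferInstanceAs (FiniteDimensional ℝ E)

instance (x : M) : T2Space (TangentSpace 𝓘(ℝ, E) x) := inferInstanceAs (T2Space E)

/-- The Schouten bracket of decomposable multivector fields,
`∑ (-1)^(a+b) [V_a, W_b] ∧ V₁ ∧ ⋯ V̂_a ⋯ ∧ V_k ∧ W₁ ∧ ⋯ Ŵ_b ⋯ ∧ W_l`. -/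
def schoutenWedge {i j : ℕ} (V : Fin (i + 1) → VecField E M) (W : Fin (j + 1) → VecField E M) :
    MVSection E M := fun x =>
  ∑ a : Fin (i + 1), ∑ b : Fin (j + 1), (-1 : ℝ) ^ (a + b : ℕ) •
    (ExteriorAlgebra.ι ℝ (VectorField.mlieBracket 𝓘(ℝ, E) (V a) (W b) x) *
      wedge (fun s => V (a.succAbove s)) x * wedge (fun s => W (b.succAbove s)) x)

/-- The Schouten bracket `[X, Y]` of multivector fields, of multivector degrees `i + 1`, `j + 1` and
`i + j + 1`: it is given by `schoutenWedge` on wedges of vector fields and is extended by linearity.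
This is required pointwise, for all ways of writing `X` and `Y` near a point as sums of wedges. -/
def IsSchoutenBracket
    (br : ∀ i j : ℕ, MultiVec E M i →ₗ[ℝ] MultiVec E M j →ₗ[ℝ] MultiVec E M (i + j)) : Prop :=
  ∀ (i j : ℕ) (X : MultiVec E M i) (Y : MultiVec E M j) (x₀ : M)
    (l : List (Fin (i + 1) → VecField E M)) (m : List (Fin (j + 1) → VecField E M)),
    (∀ᶠ x in 𝓝 x₀, X.1 x = (l.map fun V => wedge V x).sum) →
    (∀ᶠ x in 𝓝 x₀, Y.1 x = (m.map fun W => wedge W x).sum) →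
    (br i j X Y).1 x₀ = (l.map fun V => (m.map fun W => schoutenWedge V W x₀).sum).sum

theorem contMDiff_contract {j q : ℕ} (X : MultiVec E M j) (τ : Forms E M) :
    ContMDiff 𝓘(ℝ, E) (𝓘(ℝ, E).prod 𝓘(ℝ, E [⋀^Fin q]→L[ℝ] ℝ)) ∞
      (fun x => Bundle.TotalSpace.mk' (E [⋀^Fin q]→L[ℝ] ℝ)
        (E := fun x : M => TangentSpace 𝓘(ℝ, E) x [⋀^Fin q]→L[ℝ] Bundle.Trivial M ℝ x)
        x (contractAt (X.1 x) (fun p => τ p x) q)) := by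
  rw [contMDiff_iff_chartRep]
  intro x₀
  obtain ⟨l, hl⟩ := X.2 x₀
  set y₀ := extChartAt 𝓘(ℝ, E) x₀ x₀ with hy₀
  have htgt := (isOpen_extChartAt_target (I := 𝓘(ℝ, E)) x₀).mem_nhds (mem_extChartAt_target x₀)
  obtain ⟨P, hP, hD⟩ : ∃ P : VecField E M → E → E, (∀ V, ContDiffAt ℝ ∞ (P V) y₀) ∧
      ∀ V, ∀ y ∈ (extChartAt 𝓘(ℝ, E) x₀).target,
        mfderiv 𝓘(ℝ, E) 𝓘(ℝ, E) (extChartAt 𝓘(ℝ, E) x₀).symm y (P V y) =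
          V ((extChartAt 𝓘(ℝ, E) x₀).symm y) := by
    refine ⟨fun V y => VectorField.mpullback 𝓘(ℝ, E) 𝓘(ℝ, E) (extChartAt 𝓘(ℝ, E) x₀).symm V y,
      fun V => ?_, fun V y hy => ?_⟩
    · have h1 := VectorField.contMDiffWithinAt_mpullbackWithin_extChartAt_symm (m := ∞) (n := ∞)
        (s := univ) (V.contMDiff.contMDiffAt (x := x₀)).contMDiffWithinAt uniqueMDiffOn_univ
        (mem_univ _) (by simp)
      simp only [preimage_univ, inter_univ, ModelWithCorners.Boundaryless.range_eq_univ,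
        VectorField.mpullbackWithin_univ] at h1
      have h2 := h1.contMDiffAt htgt
      rw [← contMDiffWithinAt_univ, contMDiffWithinAt_vectorSpace_iff_contDiffWithinAt] at h2
      exact h2
    · have hinv := isInvertible_mfderivWithin_extChartAt_symm (I := 𝓘(ℝ, E)) hy
      rw [ModelWithCorners.Boundaryless.range_eq_univ, mfderivWithin_univ] at hinv
      change mfderiv 𝓘(ℝ, E) 𝓘(ℝ, E) (extChartAt 𝓘(ℝ, E) x₀).symm y
        (VectorField.mpullback 𝓘(ℝ, E) 𝓘(ℝ, E) (extChartAt 𝓘(ℝ, E) x₀).symm V y) = _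
      rw [VectorField.mpullback_apply]
      exact hinv.self_apply_inverse _
  refine contDiffWithinAt_alternating (s := univ) fun w => ?_
  have hc : Tendsto (extChartAt 𝓘(ℝ, E) x₀).symm (𝓝 y₀) (𝓝 x₀) := by
    have := continuousAt_extChartAt_symm (I := 𝓘(ℝ, E)) x₀
    rwa [ContinuousAt, extChartAt_to_inv] at this
  have heq : (fun y => chartRep x₀ (fun x => contractAt (X.1 x) (fun p => τ p x) q) y w) =ᶠ[𝓝 y₀]
      fun y => (l.map fun V => chartRep x₀ (τ (j + 1 + q)) y
        (Fin.append (fun i => P (V i) y) w)).sum := by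
    filter_upwards [hc.eventually hl, htgt] with y hy hyt
    change pairing (fun p => τ p ((extChartAt 𝓘(ℝ, E) x₀).symm y))
      (X.1 ((extChartAt 𝓘(ℝ, E) x₀).symm y) * ExteriorAlgebra.ιMulti ℝ q
        (fun i => mfderiv 𝓘(ℝ, E) 𝓘(ℝ, E) (extChartAt 𝓘(ℝ, E) x₀).symm y (w i))) = _
    rw [hy, ← List.sum_map_mul_right, map_list_sum, List.map_map]
    congr 1
    refine List.map_congr_left fun V _ => ?_
    refine (contractAt_ιMulti (fun i => V i ((extChartAt 𝓘(ℝ, E) x₀).symm y))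
      (fun p => τ p ((extChartAt 𝓘(ℝ, E) x₀).symm y)) q _).trans ?_
    change _ = τ (j + 1 + q) ((extChartAt 𝓘(ℝ, E) x₀).symm y) (fun i =>
      mfderiv 𝓘(ℝ, E) 𝓘(ℝ, E) (extChartAt 𝓘(ℝ, E) x₀).symm y
        (Fin.append (fun i => P (V i) y) w i))
    congr 1
    funext i
    refine Fin.addCases (fun i => ?_) (fun i => ?_) i
    · rw [Fin.append_left]
      exact (hD (V i) y hyt).symm.trans (congrArg
        (mfderiv 𝓘(ℝ, E) 𝓘(ℝ, E) (extChartAt 𝓘(ℝ, E) x₀).symm y)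
        (Fin.append_left (α := E) (fun i => P (V i) y) w i).symm)
    · rw [Fin.append_right]
      exact congrArg (mfderiv 𝓘(ℝ, E) 𝓘(ℝ, E) (extChartAt 𝓘(ℝ, E) x₀).symm y)
        (Fin.append_right (α := E) (fun i => P (V i) y) w i).symm
  have hsum : ∀ l : List (Fin (j + 1) → VecField E M), ContDiffAt ℝ ∞ (fun y =>
      (l.map fun V => chartRep x₀ (τ (j + 1 + q)) y
        (Fin.append (fun i => P (V i) y) w)).sum) y₀ := by
    intro l
    induction l with
    | nil => simpa using contDiffAt_const
    | cons V l ih =>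
      simp only [List.map_cons, List.sum_cons]
      refine ContDiffAt.add ?_ ih
      refine contDiffWithinAt_alternating_apply (s := univ)
        (u := fun i y => Fin.append (fun i => P (V i) y) w i)
        ((τ (j + 1 + q)).contDiffAt_chartRep x₀ (mem_extChartAt_target x₀)) fun i => ?_
      refine Fin.addCases (fun i => ?_) (fun i => ?_) i
      · simp only [Fin.append_left]
        exact hP (V i)
      · simp only [Fin.append_right]
        exact contDiffWithinAt_const
  exact (hsum l).congr_of_eventuallyEq heq

/-- The contraction `X ⌟ τ`, with `(X₁ ∧ ⋯ ∧ X_k) ⌟ τ = X_k ⌟ ⋯ ⌟ X₁ ⌟ τ = τ(X₁, …, X_k, ·, …, ·)`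
(see `contractAt_ιMulti`). -/
def contract {j : ℕ} : MultiVec E M j →ₗ[ℝ] Forms E M →ₗ[ℝ] Forms E M :=
  LinearMap.mk₂ ℝ
    (fun X τ q => ⟨fun x => contractAt (X.1 x) (fun p => τ p x) q, contMDiff_contract X τ⟩)
    (fun X Y τ => by
      funext q
      ext x : 1
      exact contractAt_add_left (X.1 x) (Y.1 x) (fun p => τ p x) q)
    (fun c X τ => by
      funext q
      ext x : 1
      exact contractAt_smul_left c (X.1 x) (fun p => τ p x) q)
    (fun X τ σ => by
      funext q
      ext x : 1
      exact contractAt_add_right (X.1 x) (fun p => τ p x) (fun p => σ p x) q)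
    (fun c X τ => by
      funext q
      ext x : 1
      exact contractAt_smul_right c (X.1 x) (fun p => τ p x) q)

/-- The Lie derivative along a `k`-vector field, `k = j + 1`:
`L_X τ = d(X ⌟ τ) - (-1)ᵏ X ⌟ dτ`. -/
def lieDeriv {j : ℕ} : MultiVec E M j →ₗ[ℝ] Forms E M →ₗ[ℝ] Forms E M :=
  contract.compr₂ Forms.d - (-1 : ℝ) ^ (j + 1) • contract.compl₂ Forms.d

theorem lieDeriv_apply {j : ℕ} (X : MultiVec E M j) (τ : Forms E M) :
    lieDeriv X τ = Forms.d (contract X τ) - (-1 : ℝ) ^ (j + 1) • contract X (Forms.d τ) := rfl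

/-- A graded Lie bracket of degree `0` on the graded vector space `⨁ i, L i`: the bracket is graded
skew-symmetric and satisfies the graded Jacobi identity. -/
def IsGradedLieBracket {L : ℕ → Type*} [∀ i, AddCommGroup (L i)] [∀ i, Module ℝ (L i)]
    (br : ∀ i j : ℕ, L i →ₗ[ℝ] L j →ₗ[ℝ] L (i + j)) : Prop :=
  (∀ (i j : ℕ) (x : L i) (y : L j),
    DirectSum.of L (i + j) (br i j x y) =
      -((-1 : ℝ) ^ (i * j) • DirectSum.of L (j + i) (br j i y x))) ∧
  ∀ (i j k : ℕ) (x : L i) (y : L j) (z : L k),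
    (-1 : ℝ) ^ (i * k) • DirectSum.of L (i + (j + k)) (br i (j + k) x (br j k y z)) +
    (-1 : ℝ) ^ (j * i) • DirectSum.of L (j + (k + i)) (br j (k + i) y (br k i z x)) +
    (-1 : ℝ) ^ (k * j) • DirectSum.of L (k + (i + j)) (br k (i + j) z (br i j x y)) = 0

/-- The three kinds of conserved quantities and of continuous symmetries. -/
inductive Kind
  | loc
  | glob
  | str

/-- The closed forms, the exact forms, and the zero form, respectively. -/
def Kind.forms : Kind → Submodule ℝ (Forms E M)
  | Kind.loc => LinearMap.ker Forms.d
  | Kind.glob => LinearMap.range Forms.d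
  | Kind.str => ⊥

variable (E M) in
/-- A multi-Hamiltonian system `(M, ω, H)`: an `n`-plectic form `ω` on `M` (a closed `(n+1)`-form
such that `v ↦ v ⌟ ω` is injective on tangent vectors), a Hamiltonian `(n-1)`-form `H`, and the
vector field `X_H` with `dH = -X_H ⌟ ω`. -/
structure MultiHamiltonianSystem (n : ℕ) where
  form : Form E M (n + 1)
  closed : Form.d form = 0
  nondegenerate : ∀ (x : M) (v : TangentSpace 𝓘(ℝ, E) x),
    (∀ w : Fin n → TangentSpace 𝓘(ℝ, E) x, form x (Fin.cons v w) = 0) → v = 0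
  H : Form E M (n - 1)
  XH : MultiVec E M 0
  hamiltonian : Forms.d (Forms.of H) = -contract XH (Forms.of form)

namespace MultiHamiltonianSystem

variable {n : ℕ} (sys : MultiHamiltonianSystem E M n)

/-- The form `ω`, as an element of the space of all forms. -/
def plecticForm : Forms E M := Forms.of sys.form

/-- The form `H`, as an element of the space of all forms. -/
def hamiltonianForm : Forms E M := Forms.of sys.H

/-- `X` is a Hamiltonian multivector field of the form `α`: `dα = -X ⌟ ω`. -/
def IsHamiltonianField {j : ℕ} (α : Forms E M) (X : MultiVec E M j) : Prop :=
  Forms.d α = -contract X sys.plecticForm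

/-- The Poisson bracket `{α, β} = (-1)^(l+1) X_β ⌟ X_α ⌟ ω` of two Hamiltonian forms, expressed
through their Hamiltonian multivector fields; `l = j + 1` is the degree of `X_β`. -/
def poissonBracket {i j : ℕ} (Xα : MultiVec E M i) (Xβ : MultiVec E M j) : Forms E M :=
  (-1 : ℝ) ^ (j + 1 + 1) • contract Xβ (contract Xα sys.plecticForm)

/-- The Hamiltonian `(j+1)`-vector fields: `X ⌟ ω` is exact. -/
def hamiltonianFields (j : ℕ) : Submodule ℝ (MultiVec E M j) where
  carrier := {X | contract X sys.plecticForm ∈ LinearMap.range (Forms.d (E := E) (M := M))}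
  zero_mem' := by
    rw [mem_ofPred_eq, map_zero, LinearMap.zero_apply]
    exact zero_mem _
  add_mem' hX hY := by
    simp only [mem_ofPred_eq, map_add, LinearMap.add_apply] at *
    exact add_mem hX hY
  smul_mem' c X hX := by
    simp only [mem_ofPred_eq, map_smul, LinearMap.smul_apply] at *
    exact Submodule.smul_mem _ c hX

/-- The continuous symmetries of degree `j + 1`: the Hamiltonian multivector fields `X` for which
`L_X H` is closed, exact or zero. -/
def symmetries (t : Kind) (j : ℕ) : Submodule ℝ (MultiVec E M j) where
  carrier := {X | X ∈ sys.hamiltonianFields j ∧ lieDeriv X sys.hamiltonianForm ∈ t.forms}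
  zero_mem' := by simp
  add_mem' hX hY := by
    simp only [mem_ofPred_eq, map_add, LinearMap.add_apply] at *
    exact ⟨add_mem hX.1 hY.1, add_mem hX.2 hY.2⟩
  smul_mem' c X hX := by
    simp only [mem_ofPred_eq, map_smul, LinearMap.smul_apply] at *
    exact ⟨Submodule.smul_mem _ c hX.1, Submodule.smul_mem _ c hX.2⟩

/-- The conserved quantities of degree `n - k`, `k = j + 1` (there are no nonzero ones if `k > n`):
the Hamiltonian `(n-k)`-forms `α` for which `L_{X_H} α` is closed, exact or zero. -/
def conserved (t : Kind) (j : ℕ) : Submodule ℝ (Forms E M) where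
  carrier := {α | (∀ p, p + (j + 1) ≠ n → α p = 0) ∧
    (∃ X : MultiVec E M j, sys.IsHamiltonianField α X) ∧ lieDeriv sys.XH α ∈ t.forms}
  zero_mem' := ⟨fun _ _ => rfl, ⟨0, by simp [IsHamiltonianField]⟩, by simp⟩
  add_mem' := by
    rintro α β ⟨h1, ⟨X, hX⟩, h2⟩ ⟨h3, ⟨Y, hY⟩, h4⟩
    refine ⟨fun p hp => ?_, ⟨X + Y, ?_⟩, ?_⟩
    · rw [Forms.add_apply, h1 p hp, h3 p hp, add_zero]
    · simp only [IsHamiltonianField, map_add, LinearMap.add_apply, neg_add] at *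
      rw [hX, hY]
    · rw [map_add]
      exact add_mem h2 h4
  smul_mem' := by
    rintro c α ⟨h1, ⟨X, hX⟩, h2⟩
    refine ⟨fun p hp => ?_, ⟨c • X, ?_⟩, ?_⟩
    · rw [Forms.smul_apply, h1 p hp]
      exact smul_zero (A := Form E M p) c
    · simp only [IsHamiltonianField, map_smul, LinearMap.smul_apply] at *
      rw [hX, smul_neg]
    · rw [map_smul]
      exact Submodule.smul_mem _ c h2

/-- The kernel of `ω` in degree `j + 1`: the multivector fields `κ` with `κ ⌟ ω = 0`. -/
def kernel (j : ℕ) : Submodule ℝ (MultiVec E M j) :=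
  LinearMap.ker (contract.flip sys.plecticForm)

/-- The conserved quantities modulo the closed forms. -/
def ConservedQuot (t : Kind) (j : ℕ) : Type _ :=
  sys.conserved t j ⧸ (LinearMap.ker Forms.d).submoduleOf (sys.conserved t j)

instance (t : Kind) (j : ℕ) : AddCommGroup (sys.ConservedQuot t j) :=
  inferInstanceAs
    (AddCommGroup (sys.conserved t j ⧸ (LinearMap.ker Forms.d).submoduleOf (sys.conserved t j)))

instance (t : Kind) (j : ℕ) : Module ℝ (sys.ConservedQuot t j) :=
  inferInstanceAs
    (Module ℝ (sys.conserved t j ⧸ (LinearMap.ker Forms.d).submoduleOf (sys.conserved t j)))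

/-- The class of a conserved quantity modulo the closed forms. -/
def conservedClass (t : Kind) (j : ℕ) : sys.conserved t j →ₗ[ℝ] sys.ConservedQuot t j :=
  Submodule.mkQ _

/-- The continuous symmetries modulo the kernel of `ω`. -/
def SymmetryQuot (t : Kind) (j : ℕ) : Type _ :=
  sys.symmetries t j ⧸ (sys.kernel j).submoduleOf (sys.symmetries t j)

instance (t : Kind) (j : ℕ) : AddCommGroup (sys.SymmetryQuot t j) :=
  inferInstanceAs
    (AddCommGroup (sys.symmetries t j ⧸ (sys.kernel j).submoduleOf (sys.symmetries t j)))

instance (t : Kind) (j : ℕ) : Module ℝ (sys.SymmetryQuot t j) :=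
  inferInstanceAs
    (Module ℝ (sys.symmetries t j ⧸ (sys.kernel j).submoduleOf (sys.symmetries t j)))

/-- The class of a continuous symmetry modulo the kernel of `ω`. -/
def symmetryClass (t : Kind) (j : ℕ) : sys.symmetries t j →ₗ[ℝ] sys.SymmetryQuot t j :=
  Submodule.mkQ _

end MultiHamiltonianSystem

end Multisymplectic

end

open Multisymplectic

/-!
Contraction embeds the multivector fields faithfully into the operators on differential forms,
because a manifold carries enough forms to separate multivectors. Write `i_X` for the contraction
and `L_X = [d, i_X]` for the graded commutator. Cartan's formula `[L_V, i_W] = i_[V, W]` for vector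
fields shows that the Schouten bracket contracts as the derived bracket `[[d, i_X], i_Y]`; this
determines it, and its graded Lie identities become formal consequences of `d² = 0` and of the
graded commutation of the contractions.

If `X` and `Y` are Hamiltonian, then `i_[X, Y] ω` is, up to sign, `d (i_Y i_X ω)`, so that
`[X_α, X_β]` is a Hamiltonian multivector field of `{α, β}`. If `X` is a Hamiltonian multivector
field of `α`, then `L_{X_H} α + L_X H` is exact, so that conserved quantities and continuous
symmetries correspond to each other. The quotients by `ker d` and `ker ω` embed into the space of
forms by `α ↦ dα` and `X ↦ -i_X ω`, with the same image, whence the isomorphism `[α] ↦ [X_α]`; it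
carries the Schouten bracket to the Poisson bracket.
-/

namespace Multisymplectic

noncomputable section

section GradedOperators

variable (𝕜 : Type*) {R : Type*} [CommRing 𝕜] [Ring R] [Algebra 𝕜 R]

theorem list_prod_mul_of_anticomm {l : List R} {x : R} (h : ∀ a ∈ l, a * x = -(x * a)) :
    l.prod * x = (-1 : 𝕜) ^ l.length • (x * l.prod) := by
  induction l with
  | nil => simp
  | cons a l ih =>
    rw [List.forall_mem_cons] at h
    rw [List.prod_cons, mul_assoc, ih h.2, mul_smul_comm, ← mul_assoc, h.1, List.length_cons,
      pow_succ, mul_neg_one, neg_smul, neg_mul, smul_neg, mul_assoc]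

theorem list_prod_mul_list_prod_of_anticomm {l m : List R}
    (h : ∀ a ∈ l, ∀ b ∈ m, a * b = -(b * a)) :
    l.prod * m.prod = (-1 : 𝕜) ^ (l.length * m.length) • (m.prod * l.prod) := by
  induction m with
  | nil => simp
  | cons b m ih =>
    rw [List.prod_cons, ← mul_assoc,
      list_prod_mul_of_anticomm 𝕜 fun a ha => h a ha b List.mem_cons_self, smul_mul_assoc,
      mul_assoc, ih fun a ha c hc => h a ha c (List.mem_cons_of_mem b hc), mul_smul_comm, smul_smul,
      ← pow_add, ← mul_assoc, List.length_cons, mul_add_one, add_comm]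

/-- The product `v_{k-1} * ⋯ * v_0` of a family of ring elements in reverse order. The contraction
by `v_0 ∧ ⋯ ∧ v_{k-1}` is such a product of the contractions by the factors. -/
def revProd {k : ℕ} (v : Fin k → R) : R := (List.ofFn v).reverse.prod

theorem revProd_zero (v : Fin 0 → R) : revProd v = 1 := by simp [revProd]

theorem revProd_succ {k : ℕ} (v : Fin (k + 1) → R) :
    revProd v = revProd (Fin.tail v) * v 0 := by
  simp [revProd, List.ofFn_succ, Fin.tail_def]

theorem revProd_removeNth_succ {k : ℕ} (v : Fin (k + 2) → R) (s : Fin (k + 1)) :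
    revProd (s.succ.removeNth v) = revProd (s.removeNth (Fin.tail v)) * v 0 := by
  rw [revProd_succ]
  congr 2
  funext r
  simp [Fin.removeNth, Fin.tail_def]

theorem revProd_append {k l : ℕ} (v : Fin k → R) (w : Fin l → R) :
    revProd (Fin.append v w) = revProd w * revProd v := by
  simp [revProd, List.ofFn_fin_append]

theorem revProd_mul_revProd {k l : ℕ} {v : Fin k → R} {w : Fin l → R}
    (h : ∀ i j, v i * w j = -(w j * v i)) :
    revProd v * revProd w = (-1 : 𝕜) ^ (k * l) • (revProd w * revProd v) := by
  have key := list_prod_mul_list_prod_of_anticomm 𝕜 (l := (List.ofFn v).reverse)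
    (m := (List.ofFn w).reverse) (by simpa [List.forall_mem_ofFn_iff] using h)
  simpa only [List.length_reverse, List.length_ofFn, revProd] using key

/-- The graded commutator of an operator `d` of degree `1` with an operator `x` of degree `-k`. It
is the Lie derivative if `d` is the exterior derivative and `x` the contraction by a `k`-vector
field. -/
def gradedCommutator (d : R) (k : ℕ) (x : R) : R := d * x - (-1 : 𝕜) ^ k • (x * d)

/-- The bracket `(-1)^(i(j+1)) L_x y - y L_x` derived from `d`, where `L_x` is the graded commutator
of `d` and `x`, of two operators `x` and `y` of degrees `-(i+1)` and `-(j+1)`. -/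
def derivedBracket (d : R) (i j : ℕ) (x y : R) : R :=
  (-1 : 𝕜) ^ (i * (j + 1)) • (gradedCommutator 𝕜 d (i + 1) x * y) -
    y * gradedCommutator 𝕜 d (i + 1) x

theorem gradedCommutator_mul (d x y : R) (k : ℕ) :
    gradedCommutator 𝕜 d (k + 1) (x * y) =
      gradedCommutator 𝕜 d k x * y + (-1 : 𝕜) ^ k • (x * gradedCommutator 𝕜 d 1 y) := by
  rcases neg_one_pow_eq_or 𝕜 k with hk | hk <;>
    simp only [gradedCommutator, pow_succ, hk, pow_zero, mul_neg, mul_one, neg_neg, neg_smul,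
      one_smul] <;> noncomm_ring

theorem derivedBracket_mul_left (d : R) {i j : ℕ} {x v y : R}
    (hv : v * y = (-1 : 𝕜) ^ (j + 1) • (y * v))
    (hx : y * x = (-1 : 𝕜) ^ ((j + 1) * (i + 1)) • (x * y)) :
    derivedBracket 𝕜 d (i + 1) j (x * v) y = derivedBracket 𝕜 d i j x y * v +
      (-1 : 𝕜) ^ (j * (i + 1)) • (x * derivedBracket 𝕜 d 0 j v y) := by
  have hx' : y * (x * gradedCommutator 𝕜 d 1 v) =
      (-1 : 𝕜) ^ ((j + 1) * (i + 1)) • (x * (y * gradedCommutator 𝕜 d 1 v)) := by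
    rw [← mul_assoc, hx, smul_mul_assoc, mul_assoc]
  simp only [derivedBracket, gradedCommutator_mul, add_mul, mul_add, mul_sub, sub_mul, smul_sub,
    smul_add, mul_smul_comm, smul_mul_assoc, mul_assoc, hv, hx', zero_add]
  rcases neg_one_pow_eq_or 𝕜 i with hi | hi <;> rcases neg_one_pow_eq_or 𝕜 j with hj | hj <;>
    simp only [pow_add, pow_mul, hi, hj, one_mul, mul_one, pow_one, one_pow, neg_smul, one_smul,
      mul_neg, neg_neg, smul_neg, pow_zero, mul_comm j i] <;> abel

theorem commutator_revProd {l : ℕ} {a : R} {w c : Fin (l + 1) → R}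
    (ha : ∀ t, a * w t - w t * a = c t) (hc : ∀ s t, w s * c t = -(c t * w s)) :
    a * revProd w - revProd w * a =
      ∑ t : Fin (l + 1), (-1 : 𝕜) ^ (t : ℕ) • (revProd (t.removeNth w) * c t) := by
  induction l with
  | zero => simp [revProd_succ, revProd_zero, ha]
  | succ l ih =>
    have ih' := ih (w := Fin.tail w) (c := fun t => c t.succ) (fun t => ha t.succ)
      fun s t => hc s.succ t.succ
    have leibniz : a * revProd w - revProd w * a = revProd (Fin.tail w) * (a * w 0 - w 0 * a) +
        (a * revProd (Fin.tail w) - revProd (Fin.tail w) * a) * w 0 := by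
      rw [revProd_succ]
      noncomm_ring
    rw [leibniz, ih', ha, Fin.sum_univ_succ (n := l + 1), Finset.sum_mul]
    congr 1
    · simp
    · refine Finset.sum_congr rfl fun t _ => ?_
      rw [revProd_removeNth_succ, mul_assoc (revProd _), hc, smul_mul_assoc, mul_neg, Fin.val_succ,
        pow_succ, mul_neg_one, neg_smul, smul_neg, neg_neg, mul_assoc]

theorem derivedBracket_revProd_right {j : ℕ} {d x : R} {w c : Fin (j + 1) → R}
    (hd : ∀ t, derivedBracket 𝕜 d 0 0 x (w t) = c t) (hw : ∀ s t, w s * c t = -(c t * w s)) :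
    derivedBracket 𝕜 d 0 j x (revProd w) =
      ∑ t : Fin (j + 1), (-1 : 𝕜) ^ (t : ℕ) • (revProd (t.removeNth w) * c t) := by
  rw [← commutator_revProd 𝕜 (a := gradedCommutator 𝕜 d 1 x) (fun t => ?_) hw]
  · simp [derivedBracket]
  · simpa [derivedBracket] using hd t

/-- The Cartan formula `[[d, v_s], w_t] = c_st`, extended from operators of degree `-1` to their
products: the right-hand side is the pattern of the Schouten bracket. -/
theorem derivedBracket_revProd {i j : ℕ} {d : R} {v : Fin (i + 1) → R} {w : Fin (j + 1) → R}
    {c : Fin (i + 1) → Fin (j + 1) → R} (hvw : ∀ s t, v s * w t = -(w t * v s))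
    (hd : ∀ s t, derivedBracket 𝕜 d 0 0 (v s) (w t) = c s t)
    (hv : ∀ r s t, v r * c s t = -(c s t * v r)) (hw : ∀ r s t, w r * c s t = -(c s t * w r)) :
    derivedBracket 𝕜 d i j (revProd v) (revProd w) =
      ∑ s : Fin (i + 1), ∑ t : Fin (j + 1), (-1 : 𝕜) ^ (s + t : ℕ) •
        (revProd (t.removeNth w) * (revProd (s.removeNth v) * c s t)) := by
  have hd0 : ∀ s, derivedBracket 𝕜 d 0 j (v s) (revProd w) =
      ∑ t : Fin (j + 1), (-1 : 𝕜) ^ (t : ℕ) • (revProd (t.removeNth w) * c s t) :=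
    fun s => derivedBracket_revProd_right 𝕜 (hd s) fun r t => hw r s t
  induction i with
  | zero => simpa [revProd_succ v, revProd_zero] using hd0 0
  | succ i ih =>
    have ih' := ih (v := Fin.tail v) (c := fun s => c s.succ) (fun s t => hvw s.succ t)
      (fun s t => hd s.succ t) (fun r s t => hv r.succ s.succ t) (fun r s t => hw r s.succ t)
      fun s => hd0 s.succ
    have hv0 : v 0 * revProd w = (-1 : 𝕜) ^ (j + 1) • (revProd w * v 0) := by
      simpa [revProd_succ, revProd_zero, Fin.tail_def] using
        revProd_mul_revProd 𝕜 (v := fun _ : Fin 1 => v 0) fun _ t => hvw 0 t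
    have hwv : ∀ s t, w t * v s = -(v s * w t) := fun s t => by rw [hvw, neg_neg]
    have hwA : revProd w * revProd (Fin.tail v) =
        (-1 : 𝕜) ^ ((j + 1) * (i + 1)) • (revProd (Fin.tail v) * revProd w) :=
      revProd_mul_revProd 𝕜 fun t s => hwv s.succ t
    rw [revProd_succ v, derivedBracket_mul_left 𝕜 d hv0 hwA, ih', hd0 0,
      Fin.sum_univ_succ (n := i + 1), add_comm, Finset.mul_sum, Finset.smul_sum, Finset.sum_mul]
    congr 1
    · refine Finset.sum_congr rfl fun t _ => ?_
      have hAw : revProd (t.removeNth w) * revProd (Fin.tail v) =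
          (-1 : 𝕜) ^ (j * (i + 1)) • (revProd (Fin.tail v) * revProd (t.removeNth w)) :=
        revProd_mul_revProd 𝕜 fun r s => hwv s.succ (t.succAbove r)
      rw [Fin.removeNth_zero, ← mul_assoc (revProd (t.removeNth w)), hAw, mul_smul_comm, smul_comm,
        smul_mul_assoc, mul_assoc, Fin.val_zero, zero_add]
    · refine Finset.sum_congr rfl fun s _ => ?_
      rw [Finset.sum_mul]
      refine Finset.sum_congr rfl fun t _ => ?_
      rw [revProd_removeNth_succ, mul_assoc _ (v 0), hv, Fin.val_succ, add_right_comm (s : ℕ),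
        pow_succ, mul_neg_one, neg_smul, mul_neg, mul_neg, smul_neg, neg_neg, smul_mul_assoc,
        mul_assoc, mul_assoc]

theorem derivedBracket_skew (d : R) {i j : ℕ} {x y : R}
    (h : x * y = (-1 : 𝕜) ^ ((i + 1) * (j + 1)) • (y * x)) :
    derivedBracket 𝕜 d i j x y = -((-1 : 𝕜) ^ (i * j) • derivedBracket 𝕜 d j i y x) := by
  have h' : ∀ w, x * (y * w) = (-1 : 𝕜) ^ ((i + 1) * (j + 1)) • (y * (x * w)) := fun w => by
    rw [← mul_assoc, h, smul_mul_assoc, mul_assoc]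
  simp only [derivedBracket, gradedCommutator, sub_mul, mul_sub, smul_mul_assoc, mul_smul_comm,
    mul_assoc, h, h']
  rcases neg_one_pow_eq_or 𝕜 i with hi | hi <;> rcases neg_one_pow_eq_or 𝕜 j with hj | hj <;>
    simp only [mul_add, add_mul, pow_add, pow_mul, hi, hj, one_mul, mul_one, pow_one, one_pow,
      neg_smul, one_smul, neg_neg, smul_neg, mul_comm j i, mul_neg] <;> abel

theorem gradedCommutator_derivedBracket {d : R} (hd : d * d = 0) (i j : ℕ) (x y : R) :
    gradedCommutator 𝕜 d (i + j + 1) (derivedBracket 𝕜 d i j x y) =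
      (-1 : 𝕜) ^ (i * j) • (gradedCommutator 𝕜 d (i + 1) x * gradedCommutator 𝕜 d (j + 1) y) -
        gradedCommutator 𝕜 d (j + 1) y * gradedCommutator 𝕜 d (i + 1) x := by
  have hd' : ∀ w, d * (d * w) = 0 := fun w => by rw [← mul_assoc, hd, zero_mul]
  rcases neg_one_pow_eq_or 𝕜 i with hi | hi <;> rcases neg_one_pow_eq_or 𝕜 j with hj | hj <;>
    simp only [derivedBracket, gradedCommutator, sub_mul, mul_sub, mul_assoc, hd, hd', mul_add,
      add_mul, pow_add, pow_mul, hi, hj, mul_one, pow_one, one_pow, neg_smul, one_smul, mul_neg,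
      neg_neg, neg_mul, mul_zero, sub_neg_eq_add] <;> abel

/-- The Jacobi identity reduces to `L_[x,y] = ± L_x L_y - L_y L_x`. -/
theorem derivedBracket_jacobi {d : R} (hd : d * d = 0) {i j k : ℕ} {x y z : R}
    (hzx : z * x = (-1 : 𝕜) ^ ((k + 1) * (i + 1)) • (x * z))
    (hz : z * derivedBracket 𝕜 d i j x y =
      (-1 : 𝕜) ^ ((k + 1) * (i + j + 1)) • (derivedBracket 𝕜 d i j x y * z)) :
    (-1 : 𝕜) ^ (i * k) • derivedBracket 𝕜 d i (j + k) x (derivedBracket 𝕜 d j k y z) +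
      (-1 : 𝕜) ^ (j * i) • derivedBracket 𝕜 d j (k + i) y (derivedBracket 𝕜 d k i z x) +
      (-1 : 𝕜) ^ (k * j) • derivedBracket 𝕜 d k (i + j) z (derivedBracket 𝕜 d i j x y) = 0 := by
  rw [derivedBracket_skew 𝕜 d hz, derivedBracket_skew 𝕜 d hzx]
  have h := gradedCommutator_derivedBracket 𝕜 hd i j x y
  generalize derivedBracket 𝕜 d i j x y = w at h
  simp only [derivedBracket, h]
  generalize gradedCommutator 𝕜 d (i + 1) x = a
  generalize gradedCommutator 𝕜 d (j + 1) y = b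
  rcases neg_one_pow_eq_or 𝕜 i with hi | hi <;> rcases neg_one_pow_eq_or 𝕜 j with hj | hj <;>
    rcases neg_one_pow_eq_or 𝕜 k with hk | hk <;>
    simp only [sub_mul, mul_sub, mul_assoc, mul_add, add_mul, pow_add, pow_mul, hi, hj, hk, mul_one,
      one_pow, neg_smul, one_smul,
      mul_neg, neg_neg, smul_neg, neg_mul, sub_neg_eq_add] <;> abel

end GradedOperators

section Calculus

variable {𝕜 E F : Type*} [NontriviallyNormedField 𝕜] [NormedAddCommGroup E] [NormedSpace 𝕜 E]
  [NormedAddCommGroup F] [NormedSpace 𝕜 F]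

theorem fderiv_curryLeft_apply {q : ℕ} {f : E → E [⋀^Fin (q + 1)]→L[𝕜] F} {V : E → E} {y : E}
    (hf : DifferentiableAt 𝕜 f y) (hV : DifferentiableAt 𝕜 V y) (a : E) (u : Fin q → E) :
    fderiv 𝕜 (fun z => (f z).curryLeft (V z)) y a u =
      fderiv 𝕜 f y a (Fin.cons (V y) u) + f y (Fin.cons (fderiv 𝕜 V y a) u) := by
  let curry : (E [⋀^Fin (q + 1)]→L[𝕜] F) →L[𝕜] E →L[𝕜] E [⋀^Fin q]→L[𝕜] F :=
    ContinuousAlternatingMap.curryLeftLI.toContinuousLinearMap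
  have hcurry : HasFDerivAt (𝕜 := 𝕜) curry curry (f y) :=
    ContinuousLinearMap.hasFDerivAt (F := E →L[𝕜] E [⋀^Fin q]→L[𝕜] F) curry
  have hcurry_f : HasFDerivAt (𝕜 := 𝕜) (curry ∘ f) (curry.comp (fderiv 𝕜 f y)) y :=
    HasFDerivAt.comp (G := E →L[𝕜] E [⋀^Fin q]→L[𝕜] F) y hcurry hf.hasFDerivAt
  exact (congrArg (fun L => L a u) (hcurry_f.clm_apply hV.hasFDerivAt).fderiv).trans
    (add_comm _ _)

/-- The Lie derivative at `y` of a form `f` on a vector space along the vector field `V`. -/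
def lieDerivForm {p : ℕ} (f : E → E [⋀^Fin p]→L[𝕜] F) (V : E → E) (y : E) (w : Fin p → E) : F :=
  fderiv 𝕜 f y (V y) w + ∑ i, f y (Function.update w i (fderiv 𝕜 V y (w i)))

theorem lieDerivForm_congr {p : ℕ} {f g : E → E [⋀^Fin p]→L[𝕜] F} {y : E} (h : f =ᶠ[𝓝 y] g)
    (V : E → E) : lieDerivForm f V y = lieDerivForm g V y := by
  funext w
  rw [lieDerivForm, lieDerivForm, h.fderiv_eq, h.eq_of_nhds]

theorem extDeriv_apply_cons {q : ℕ} {f : E → E [⋀^Fin q]→L[𝕜] F} {y : E} (a : E) (w : Fin q → E) :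
    extDeriv f y (Fin.cons a w) = fderiv 𝕜 f y a w -
      ∑ i : Fin q, (-1 : ℤ) ^ (i : ℕ) • fderiv 𝕜 f y (w i)
        (i.succ.removeNth (Fin.cons a w : Fin (q + 1) → E)) := by
  rw [extDeriv, ContinuousAlternatingMap.alternatizeUncurryFin_apply, Fin.sum_univ_succ,
    sub_eq_add_neg, ← Finset.sum_neg_distrib]
  congr 1
  · simp
  · exact Finset.sum_congr rfl fun i _ => by simp [pow_succ]

theorem extDeriv_cons_zero (f : E → E [⋀^Fin 0]→L[𝕜] F) (V : E → E) (y : E) (w : Fin 0 → E) :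
    extDeriv f y (Fin.cons (V y) w) = lieDerivForm f V y w := by
  simp [extDeriv_apply_cons, lieDerivForm]

theorem extDeriv_curryLeft_add_extDeriv_cons {q : ℕ} {f : E → E [⋀^Fin (q + 1)]→L[𝕜] F} {V : E → E}
    {y : E} (hf : DifferentiableAt 𝕜 f y) (hV : DifferentiableAt 𝕜 V y) (w : Fin (q + 1) → E) :
    extDeriv (fun z => (f z).curryLeft (V z)) y w + extDeriv f y (Fin.cons (V y) w) =
      lieDerivForm f V y w := by
  rw [extDeriv_apply_cons, lieDerivForm, extDeriv,
    ContinuousAlternatingMap.alternatizeUncurryFin_apply, add_sub_left_comm,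
    ← Finset.sum_sub_distrib]
  congr 1
  refine Finset.sum_congr rfl fun i _ => ?_
  have hremove : i.succ.removeNth (Fin.cons (V y) w : Fin (q + 2) → E) =
      Fin.cons (V y) (i.removeNth w) := by
    funext j
    refine Fin.cases ?_ (fun j => ?_) j <;> simp [Fin.removeNth]
  rw [fderiv_curryLeft_apply hf hV, hremove, smul_add, add_sub_cancel_left,
    ← Fin.insertNth_removeNth, ContinuousAlternatingMap.map_insertNth]
  rfl

theorem lieDerivForm_curryLeft_sub {q : ℕ} {f : E → E [⋀^Fin (q + 1)]→L[𝕜] F} {V W : E → E} {y : E}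
    (hf : DifferentiableAt 𝕜 f y) (hW : DifferentiableAt 𝕜 W y) (w : Fin q → E) :
    lieDerivForm (fun z => (f z).curryLeft (W z)) V y w -
      lieDerivForm f V y (Fin.cons (W y) w) =
      f y (Fin.cons (VectorField.lieBracket 𝕜 V W y) w) := by
  have hsub : f y (Fin.cons (fderiv 𝕜 W y (V y) - fderiv 𝕜 V y (W y)) w) =
      f y (Fin.cons (fderiv 𝕜 W y (V y)) w) - f y (Fin.cons (fderiv 𝕜 V y (W y)) w) :=
    congrArg (fun g => g w) (map_sub (f y).curryLeft _ _)
  have hcurry : ∀ u, (f y).curryLeft (W y) u = f y (Fin.cons (W y) u) := fun _ => rfl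
  simp only [lieDerivForm, fderiv_curryLeft_apply hf hW, Fin.sum_univ_succ, Fin.update_cons_zero,
    Fin.cons_zero, Fin.cons_succ, ← Fin.cons_update, VectorField.lieBracket, hsub, hcurry]
  abel

end Calculus

section ExteriorAlgebra

theorem mul_comm_of_mem_exteriorPower {R V : Type*} [CommRing R] [AddCommGroup V] [Module R V]
    {k l : ℕ} {A B : ExteriorAlgebra R V} (hA : A ∈ ⋀[R]^k V) (hB : B ∈ ⋀[R]^l V) :
    A * B = (-1 : R) ^ (k * l) • (B * A) := by
  rw [← ExteriorAlgebra.ιMulti_span_fixedDegree] at hA hB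
  induction hA, hB using Submodule.span_induction₂ with
  | mem_mem A B hA hB =>
    obtain ⟨v, rfl⟩ := hA
    obtain ⟨w, rfl⟩ := hB
    have hanticomm : ∀ i j, ExteriorAlgebra.ι R (v i) * ExteriorAlgebra.ι R (w j) =
        -(ExteriorAlgebra.ι R (w j) * ExteriorAlgebra.ι R (v i)) := fun i j =>
      eq_neg_of_add_eq_zero_left (ExteriorAlgebra.ι_add_mul_swap (v i) (w j))
    simpa [ExteriorAlgebra.ιMulti_apply] using list_prod_mul_list_prod_of_anticomm R
      (l := List.ofFn fun i => ExteriorAlgebra.ι R (v i))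
      (m := List.ofFn fun j => ExteriorAlgebra.ι R (w j))
      (by simpa [List.forall_mem_ofFn_iff] using hanticomm)
  | zero_left => simp
  | zero_right => simp
  | add_left A A' B _ _ _ h h' => rw [add_mul, mul_add, smul_add, h, h']
  | add_right A B B' _ _ _ h h' => rw [add_mul, mul_add, smul_add, h, h']
  | smul_left c A B _ _ h => rw [smul_mul_assoc, mul_smul_comm, h, smul_comm]
  | smul_right c A B _ _ h => rw [smul_mul_assoc, mul_smul_comm, h, smul_comm]

variable {V : Type*} [AddCommGroup V] [Module ℝ V] [TopologicalSpace V]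

theorem pairing_ιMulti (τ : ∀ p, V [⋀^Fin p]→L[ℝ] ℝ) {p : ℕ} (v : Fin p → V) :
    pairing τ (ExteriorAlgebra.ιMulti ℝ p v) = τ p v :=
  ExteriorAlgebra.liftAlternating_apply_ιMulti _ v

variable [IsTopologicalAddGroup V] [ContinuousSMul ℝ V] [T2Space V] [FiniteDimensional ℝ V]

theorem pairing_contractAt (X Z : ExteriorAlgebra ℝ V) (τ : ∀ p, V [⋀^Fin p]→L[ℝ] ℝ) :
    pairing (contractAt X τ) Z = pairing τ (X * Z) := by
  have h : pairing (contractAt X τ) = pairing τ ∘ₗ LinearMap.mulLeft ℝ X := by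
    refine ExteriorAlgebra.lhom_ext fun q => ?_
    ext w
    exact pairing_ιMulti _ w
  exact LinearMap.congr_fun h Z

theorem contractAt_contractAt (X Y : ExteriorAlgebra ℝ V) (τ : ∀ p, V [⋀^Fin p]→L[ℝ] ℝ) :
    contractAt Y (contractAt X τ) = contractAt (X * Y) τ := by
  ext q w
  rw [contractAt_apply, contractAt_apply, pairing_contractAt, mul_assoc]

theorem contractAt_one (τ : ∀ p, V [⋀^Fin p]→L[ℝ] ℝ) : contractAt 1 τ = τ := by
  ext q w
  rw [contractAt_apply, one_mul, pairing_ιMulti]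

theorem contractAt_ι_apply (v : V) (τ : ∀ p, V [⋀^Fin p]→L[ℝ] ℝ) (q : ℕ) (w : Fin q → V) :
    contractAt (ExteriorAlgebra.ι ℝ v) τ q w = τ (q + 1) (Matrix.vecCons v w) := by
  have h : ExteriorAlgebra.ι ℝ v * ExteriorAlgebra.ιMulti ℝ q w =
      ExteriorAlgebra.ιMulti ℝ (q + 1) (Matrix.vecCons v w) := by
    simp [ExteriorAlgebra.ιMulti_succ_apply]
  rw [contractAt_apply, h, pairing_ιMulti]

theorem contractAt_eq_zero {k q : ℕ} {X : ExteriorAlgebra ℝ V} (hX : X ∈ ⋀[ℝ]^k V)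
    {τ : ∀ p, V [⋀^Fin p]→L[ℝ] ℝ} (hτ : τ (k + q) = 0) : contractAt X τ q = 0 := by
  rw [← ExteriorAlgebra.ιMulti_span_fixedDegree] at hX
  ext w
  induction hX using Submodule.span_induction with
  | mem X hX =>
    obtain ⟨v, rfl⟩ := hX
    rw [contractAt_ιMulti, hτ]
    rfl
  | zero => simp [contractAt_apply]
  | add X Y _ _ hX hY =>
    rw [contractAt_add_left, ContinuousAlternatingMap.add_apply, hX, hY]
    exact add_zero 0
  | smul c X _ hX =>
    rw [contractAt_smul_left, ContinuousAlternatingMap.smul_apply, hX]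
    exact smul_zero c

theorem eq_of_forall_pairing_eq {X Y : ExteriorAlgebra ℝ V}
    (h : ∀ τ : ∀ p, V [⋀^Fin p]→L[ℝ] ℝ, pairing τ X = pairing τ Y) : X = Y := by
  rw [← sub_eq_zero, ← Module.forall_dual_apply_eq_zero_iff ℝ]
  intro φ
  let τ : ∀ p, V [⋀^Fin p]→L[ℝ] ℝ := fun p =>
    { φ.compAlternatingMap (ExteriorAlgebra.ιMulti ℝ p) with cont := continuous_alternating _ }
  have hτ : pairing τ = φ := by
    refine ExteriorAlgebra.lhom_ext fun p => ?_
    ext w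
    exact pairing_ιMulti τ w
  rw [map_sub, ← hτ, h τ, sub_self]

end ExteriorAlgebra

section Contraction

variable {E : Type*} [NormedAddCommGroup E] [NormedSpace ℝ E]
  {M : Type*} [TopologicalSpace M] [ChartedSpace E M] [IsManifold 𝓘(ℝ, E) ∞ M]

theorem Forms.ext {τ σ : Forms E M} (h : ∀ p x, τ p x = σ p x) : τ = σ :=
  funext fun p => ContMDiffSection.ext (h p)

variable [FiniteDimensional ℝ E]

theorem contract_apply_apply {j : ℕ} (X : MultiVec E M j) (τ : Forms E M) (q : ℕ) (x : M) :
    contract X τ q x = contractAt (X.1 x) (fun p => τ p x) q := rfl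

theorem MultiVec.apply_mem_exteriorPower {j : ℕ} (X : MultiVec E M j) (x : M) :
    X.1 x ∈ ⋀[ℝ]^(j + 1) (TangentSpace 𝓘(ℝ, E) x) := by
  obtain ⟨l, hl⟩ := X.2 x
  rw [hl.self_of_nhds]
  refine list_sum_mem fun A hA => ?_
  obtain ⟨V, -, rfl⟩ := List.mem_map.1 hA
  exact ExteriorAlgebra.ιMulti_range ℝ (j + 1) (mem_range_self _)

theorem contract_mul_contract {i j : ℕ} (X : MultiVec E M i) (Y : MultiVec E M j) :
    contract X * contract Y = (-1 : ℝ) ^ ((i + 1) * (j + 1)) • (contract Y * contract X) := by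
  refine LinearMap.ext fun τ => Forms.ext fun q x => ?_
  have hXY := mul_comm_of_mem_exteriorPower (MultiVec.apply_mem_exteriorPower Y x)
    (MultiVec.apply_mem_exteriorPower X x)
  change contractAt (X.1 x) (contractAt (Y.1 x) _) q =
    (-1 : ℝ) ^ ((i + 1) * (j + 1)) • contractAt (Y.1 x) (contractAt (X.1 x) _) q
  rw [contractAt_contractAt, contractAt_contractAt, hXY, contractAt_smul_left,
    mul_comm (i + 1)]

theorem contract_contract {i j : ℕ} (X : MultiVec E M i) (Y : MultiVec E M j)
    (τ : Forms E M) : contract X (contract Y τ) =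
      (-1 : ℝ) ^ ((i + 1) * (j + 1)) • contract Y (contract X τ) :=
  LinearMap.congr_fun (contract_mul_contract X Y) τ

theorem contract_apply_eq_zero {j q : ℕ} (X : MultiVec E M j) {τ : Forms E M}
    (hτ : τ (j + 1 + q) = 0) : contract X τ q = 0 := by
  ext x : 1
  exact contractAt_eq_zero (MultiVec.apply_mem_exteriorPower X x) (by rw [hτ]; rfl)

/-- The wedge of `j + 1` vector fields, as a multivector field. -/
def wedgeField {j : ℕ} (V : Fin (j + 1) → VecField E M) : MultiVec E M j :=
  ⟨wedge V, fun _ => ⟨[V], by simp⟩⟩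

/-- The contraction by a vector field, as an operator on forms. -/
def insertVec (V : VecField E M) : Module.End ℝ (Forms E M) := contract (wedgeField ![V])

theorem insertVec_apply_apply (V : VecField E M) (τ : Forms E M) (q : ℕ) (x : M) :
    insertVec V τ q x = contractAt (ExteriorAlgebra.ι ℝ (V x)) (fun p => τ p x) q := by
  simp [insertVec, contract_apply_apply, wedgeField, wedge, ExteriorAlgebra.ιMulti_apply]

theorem insertVec_mul_insertVec (V W : VecField E M) :
    insertVec V * insertVec W = -(insertVec W * insertVec V) := by
  have h := contract_mul_contract (wedgeField ![V]) (wedgeField ![W])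
  rw [zero_add, one_mul, pow_one, neg_one_smul] at h
  exact h

theorem revProd_insertVec_apply {k : ℕ} (V : Fin k → VecField E M) (τ : Forms E M) (q : ℕ) (x : M) :
    revProd (fun i => insertVec (V i)) τ q x = contractAt (wedge V x) (fun p => τ p x) q := by
  induction k generalizing τ with
  | zero => simp [revProd_zero, wedge, contractAt_one]
  | succ k ih =>
    have hV : (fun p => insertVec (V 0) τ p x) =
        contractAt (ExteriorAlgebra.ι ℝ (V 0 x)) fun p => τ p x :=
      funext fun p => insertVec_apply_apply (V 0) τ p x
    rw [revProd_succ, Module.End.mul_apply]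
    refine (ih (Fin.tail V) (insertVec (V 0) τ)).trans ?_
    rw [hV, contractAt_contractAt, wedge, wedge, ExteriorAlgebra.ιMulti_succ_apply]
    rfl

theorem contract_wedgeField {j : ℕ} (V : Fin (j + 1) → VecField E M) :
    contract (wedgeField V) = revProd fun i => insertVec (V i) :=
  LinearMap.ext fun τ => Forms.ext fun q x => (revProd_insertVec_apply V τ q x).symm

end Contraction

section Charts

theorem minSmoothness_two_le : minSmoothness ℝ 2 ≤ (∞ : WithTop ℕ∞) := by
  rw [minSmoothness_of_isRCLikeNormedField]
  exact WithTop.coe_le_coe.2 le_top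

variable {E : Type*} [NormedAddCommGroup E] [NormedSpace ℝ E]
  {M : Type*} [TopologicalSpace M] [ChartedSpace E M]

theorem tendsto_extChartAt_symm (x₀ : M) :
    Tendsto (extChartAt 𝓘(ℝ, E) x₀).symm (𝓝 (extChartAt 𝓘(ℝ, E) x₀ x₀)) (𝓝 x₀) := by
  simpa only [ContinuousAt, extChartAt_to_inv] using
    continuousAt_extChartAt_symm (I := 𝓘(ℝ, E)) x₀

variable [IsManifold 𝓘(ℝ, E) ∞ M]

theorem isInvertible_mfderiv_extChartAt_symm {x₀ : M} {y : E}
    (hy : y ∈ (extChartAt 𝓘(ℝ, E) x₀).target) :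
    (mfderiv 𝓘(ℝ, E) 𝓘(ℝ, E) (extChartAt 𝓘(ℝ, E) x₀).symm y).IsInvertible := by
  simpa only [ModelWithCorners.Boundaryless.range_eq_univ, mfderivWithin_univ] using
    isInvertible_mfderivWithin_extChartAt_symm (I := 𝓘(ℝ, E)) hy

theorem eq_of_chartRep_eq {p : ℕ} {τ σ : ∀ x : M, TangentSpace 𝓘(ℝ, E) x [⋀^Fin p]→L[ℝ] ℝ}
    {x₀ : M} (h : chartRep x₀ τ (extChartAt 𝓘(ℝ, E) x₀ x₀) =
      chartRep x₀ σ (extChartAt 𝓘(ℝ, E) x₀ x₀)) : τ x₀ = σ x₀ := by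
  have hinv := isInvertible_mfderiv_extChartAt_symm (mem_extChartAt_target (I := 𝓘(ℝ, E)) x₀)
  have hfiber : τ ((extChartAt 𝓘(ℝ, E) x₀).symm (extChartAt 𝓘(ℝ, E) x₀ x₀)) =
      σ ((extChartAt 𝓘(ℝ, E) x₀).symm (extChartAt 𝓘(ℝ, E) x₀ x₀)) := by
    ext v
    obtain ⟨w, rfl⟩ := hinv.surjective.comp_left v
    exact congrArg (fun g => g w) h
  rwa [extChartAt_to_inv] at hfiber

variable [FiniteDimensional ℝ E]

theorem Forms.d_d (τ : Forms E M) : Forms.d (Forms.d τ) = 0 := by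
  refine Forms.ext fun p x => ?_
  match p with
  | 0 => rfl
  | 1 => exact congrArg (fun σ : Form E M 1 => σ x) (map_zero Form.d)
  | p + 2 =>
    refine eq_of_chartRep_eq (τ := fun x => Forms.d (Forms.d τ) (p + 2) x) (σ := fun _ => 0) ?_
    have hd : chartRep x (Form.d (τ p)) =ᶠ[𝓝 (extChartAt 𝓘(ℝ, E) x x)]
        extDeriv (chartRep x (τ p)) := by
      filter_upwards [extChartAt_target_mem_nhds x] with y hy
      exact (τ p).chartRep_extDerivAt x hy
    refine ((Form.d (τ p)).chartRep_extDerivAt x (mem_extChartAt_target x)).trans ?_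
    rw [hd.extDeriv_eq, extDeriv_extDeriv_apply
      ((τ p).contDiffAt_chartRep x (mem_extChartAt_target x)) minSmoothness_two_le]
    rfl

theorem Forms.d_mul_d : (Forms.d : Module.End ℝ (Forms E M)) * Forms.d = 0 :=
  LinearMap.ext Forms.d_d

end Charts

section VectorFields

variable {E : Type*} [NormedAddCommGroup E] [NormedSpace ℝ E]
  {M : Type*} [TopologicalSpace M] [ChartedSpace E M] [IsManifold 𝓘(ℝ, E) ∞ M]

/-- The expression of a vector field in the chart at `x₀`: its pullback under the inverse chart. -/
def vecRep (x₀ : M) (V : ∀ x : M, TangentSpace 𝓘(ℝ, E) x) : E → E :=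
  fun y => VectorField.mpullback 𝓘(ℝ, E) 𝓘(ℝ, E) (extChartAt 𝓘(ℝ, E) x₀).symm V y

theorem mfderiv_vecRep {x₀ : M} (V : ∀ x : M, TangentSpace 𝓘(ℝ, E) x) {y : E}
    (hy : y ∈ (extChartAt 𝓘(ℝ, E) x₀).target) :
    mfderiv 𝓘(ℝ, E) 𝓘(ℝ, E) (extChartAt 𝓘(ℝ, E) x₀).symm y (vecRep x₀ V y : E) =
      V ((extChartAt 𝓘(ℝ, E) x₀).symm y) :=
  (isInvertible_mfderiv_extChartAt_symm hy).self_apply_inverse _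

theorem isManifold_minSmoothness_two : IsManifold 𝓘(ℝ, E) (minSmoothness ℝ 2) M :=
  IsManifold.of_le minSmoothness_two_le

variable [FiniteDimensional ℝ E]

theorem differentiableAt_vecRep (x₀ : M) (V : VecField E M) :
    DifferentiableAt ℝ (vecRep x₀ V) (extChartAt 𝓘(ℝ, E) x₀ x₀) := by
  have hpullback := VectorField.contMDiffWithinAt_mpullbackWithin_extChartAt_symm (m := ∞)
    (n := ∞) (s := univ) (V.contMDiff.contMDiffAt (x := x₀)).contMDiffWithinAt uniqueMDiffOn_univ
    (mem_univ _) (by simp)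
  simp only [preimage_univ, inter_univ, ModelWithCorners.Boundaryless.range_eq_univ,
    VectorField.mpullbackWithin_univ] at hpullback
  have hsmooth := hpullback.contMDiffAt (extChartAt_target_mem_nhds x₀)
  rw [← contMDiffWithinAt_univ, contMDiffWithinAt_vectorSpace_iff_contDiffWithinAt] at hsmooth
  exact (hsmooth.contDiffAt univ_mem).differentiableAt (by simp)

theorem vecRep_mlieBracket (x₀ : M) (V W : VecField E M) :
    vecRep x₀ (VectorField.mlieBracket 𝓘(ℝ, E) V W) (extChartAt 𝓘(ℝ, E) x₀ x₀) =
      VectorField.lieBracket ℝ (vecRep x₀ V) (vecRep x₀ W) (extChartAt 𝓘(ℝ, E) x₀ x₀) := by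
  have := isManifold_minSmoothness_two (E := E) (M := M)
  have hsymm := (contMDiffOn_extChartAt_symm (I := 𝓘(ℝ, E)) (n := ∞) x₀).contMDiffAt
    (extChartAt_target_mem_nhds x₀)
  refine (VectorField.mpullback_mlieBracket (V.contMDiff.mdifferentiable (by simp) _)
    (W.contMDiff.mdifferentiable (by simp) _) hsymm minSmoothness_two_le).trans ?_
  rw [← VectorField.mlieBracketWithin_univ, VectorField.mlieBracketWithin_eq_lieBracketWithin]
  exact congrFun (VectorField.lieBracketWithin_univ (V := vecRep x₀ V) (W := vecRep x₀ W)) _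

/-- The Lie bracket of two smooth vector fields. -/
def VecField.bracket (V W : VecField E M) : VecField E M :=
  ⟨VectorField.mlieBracket 𝓘(ℝ, E) V W, by
    have := isManifold_minSmoothness_two (E := E) (M := M)
    have : IsManifold 𝓘(ℝ, E) ((⊤ : ℕ∞) + 1) M := inferInstanceAs (IsManifold 𝓘(ℝ, E) ∞ M)
    exact ContDiff.mlieBracket_vectorField (m := ⊤) (n := ⊤) V.contMDiff W.contMDiff (by simp)⟩

theorem chartRep_insertVec (V : VecField E M) (τ : Forms E M) (q : ℕ) {x₀ : M} {y : E}
    (hy : y ∈ (extChartAt 𝓘(ℝ, E) x₀).target) :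
    chartRep x₀ (insertVec V τ q) y = (chartRep x₀ (τ (q + 1)) y).curryLeft (vecRep x₀ V y) := by
  ext w
  let x := (extChartAt 𝓘(ℝ, E) x₀).symm y
  let D := mfderiv 𝓘(ℝ, E) 𝓘(ℝ, E) (extChartAt 𝓘(ℝ, E) x₀).symm y
  have hcons : Matrix.vecCons (V x) (fun i => D (w i)) =
      fun i => D ((Matrix.vecCons (vecRep x₀ V y) w : Fin (q + 1) → E) i) :=
    funext <| Fin.cases (mfderiv_vecRep V hy).symm fun _ => rfl
  change insertVec V τ q x (fun i => D (w i)) = τ (q + 1) x _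
  rw [insertVec_apply_apply, contractAt_ι_apply, hcons]
  rfl

theorem chartRep_insertVec_eventuallyEq (V : VecField E M) (τ : Forms E M) (q : ℕ) (x₀ : M) :
    chartRep x₀ (insertVec V τ q) =ᶠ[𝓝 (extChartAt 𝓘(ℝ, E) x₀ x₀)]
      fun y => (chartRep x₀ (τ (q + 1)) y).curryLeft (vecRep x₀ V y) := by
  filter_upwards [extChartAt_target_mem_nhds x₀] with y hy
  exact chartRep_insertVec V τ q hy

theorem chartRep_gradedCommutator_insertVec (V : VecField E M) (τ : Forms E M) (q : ℕ) (x₀ : M)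
    (w : Fin q → E) :
    chartRep x₀ (gradedCommutator ℝ Forms.d 1 (insertVec V) τ q) (extChartAt 𝓘(ℝ, E) x₀ x₀) w =
      lieDerivForm (chartRep x₀ (τ q)) (vecRep x₀ V) (extChartAt 𝓘(ℝ, E) x₀ x₀) w := by
  set y₀ := extChartAt 𝓘(ℝ, E) x₀ x₀
  have hy : y₀ ∈ (extChartAt 𝓘(ℝ, E) x₀).target := mem_extChartAt_target x₀
  have hcomm : gradedCommutator ℝ Forms.d 1 (insertVec V) τ =
      Forms.d (insertVec V τ) + insertVec V (Forms.d τ) := by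
    simp [gradedCommutator]
  have hinsert_d : chartRep x₀ (insertVec V (Forms.d τ) q) y₀ w =
      extDeriv (chartRep x₀ (τ q)) y₀ (Fin.cons (vecRep x₀ V y₀) w) := by
    rw [chartRep_insertVec V _ q hy, ← (τ q).chartRep_extDerivAt x₀ hy]
    rfl
  rw [hcomm]
  change chartRep x₀ (Forms.d (insertVec V τ) q) y₀ w +
    chartRep x₀ (insertVec V (Forms.d τ) q) y₀ w = _
  rw [hinsert_d]
  cases q with
  | zero => exact (zero_add _).trans (extDeriv_cons_zero _ _ _ w)
  | succ q =>
    have hd_insert : chartRep x₀ (Forms.d (insertVec V τ) (q + 1)) y₀ w =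
        extDeriv (fun y => (chartRep x₀ (τ (q + 1)) y).curryLeft (vecRep x₀ V y)) y₀ w := by
      rw [← (chartRep_insertVec_eventuallyEq V τ q x₀).extDeriv_eq,
        ← (insertVec V τ q).chartRep_extDerivAt x₀ hy]
      rfl
    rw [hd_insert, extDeriv_curryLeft_add_extDeriv_cons
      (((τ (q + 1)).contDiffAt_chartRep x₀ hy).differentiableAt (by simp))
      (differentiableAt_vecRep x₀ V)]

theorem gradedCommutator_insertVec_mul_sub (V W : VecField E M) :
    gradedCommutator ℝ Forms.d 1 (insertVec V) * insertVec W -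
      insertVec W * gradedCommutator ℝ Forms.d 1 (insertVec V) = insertVec (V.bracket W) := by
  refine LinearMap.ext fun τ => Forms.ext fun q x => eq_of_chartRep_eq ?_
  set L := gradedCommutator ℝ Forms.d 1 (insertVec V)
  set y := extChartAt 𝓘(ℝ, E) x x
  have hy : y ∈ (extChartAt 𝓘(ℝ, E) x).target := mem_extChartAt_target x
  ext w
  have hLW : chartRep x (L (insertVec W τ) q) y w = lieDerivForm
      (fun z => (chartRep x (τ (q + 1)) z).curryLeft (vecRep x W z)) (vecRep x V) y w := by
    rw [chartRep_gradedCommutator_insertVec,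
      lieDerivForm_congr (chartRep_insertVec_eventuallyEq W τ q x)]
  have hWL : chartRep x (insertVec W (L τ) q) y w = lieDerivForm
      (chartRep x (τ (q + 1))) (vecRep x V) y (Fin.cons (vecRep x W y) w) := by
    rw [chartRep_insertVec W (L τ) q hy]
    exact chartRep_gradedCommutator_insertVec V τ (q + 1) x _
  have hVW : chartRep x (insertVec (V.bracket W) τ q) y w = chartRep x (τ (q + 1)) y
      (Fin.cons (VectorField.lieBracket ℝ (vecRep x V) (vecRep x W) y) w) := by
    rw [chartRep_insertVec (V.bracket W) τ q hy, ← vecRep_mlieBracket]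
    rfl
  refine (congrArg₂ (· - ·) hLW hWL).trans ?_
  rw [hVW, lieDerivForm_curryLeft_sub
    (((τ (q + 1)).contDiffAt_chartRep x hy).differentiableAt (by simp))
    (differentiableAt_vecRep x W)]

end VectorFields

section Locality

variable {E : Type*} [NormedAddCommGroup E] [NormedSpace ℝ E]
  {M : Type*} [TopologicalSpace M] [ChartedSpace E M] [IsManifold 𝓘(ℝ, E) ∞ M]

/-- Two differential forms agree near the point `x₀`. -/
def AgreeNear (x₀ : M) (τ σ : Forms E M) : Prop := ∀ᶠ x in 𝓝 x₀, ∀ p, τ p x = σ p x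

namespace AgreeNear

variable {x₀ : M} {τ σ τ' σ' : Forms E M}

theorem eq (h : AgreeNear x₀ τ σ) (p : ℕ) : τ p x₀ = σ p x₀ := h.self_of_nhds p

theorem sub (h : AgreeNear x₀ τ σ) (h' : AgreeNear x₀ τ' σ') :
    AgreeNear x₀ (τ - τ') (σ - σ') := by
  filter_upwards [h, h'] with x hx hx' p
  exact congrArg₂ (· - ·) (hx p) (hx' p)

theorem smul (h : AgreeNear x₀ τ σ) (c : ℝ) : AgreeNear x₀ (c • τ) (c • σ) := by
  filter_upwards [h] with x hx p
  exact congrArg (c • ·) (hx p)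

variable [FiniteDimensional ℝ E]

theorem d (h : AgreeNear x₀ τ σ) : AgreeNear x₀ (Forms.d τ) (Forms.d σ) := by
  filter_upwards [h.eventually_nhds] with x hx p
  cases p with
  | zero => rfl
  | succ p =>
    have hrep : chartRep x (τ p) =ᶠ[𝓝 (extChartAt 𝓘(ℝ, E) x x)] chartRep x (σ p) := by
      filter_upwards [(tendsto_extChartAt_symm x).eventually hx] with y hy
      rw [chartRep, chartRep, hy p]
    change extDerivAt (τ p) x = extDerivAt (σ p) x
    rw [extDerivAt, extDerivAt, hrep.extDeriv_eq]

theorem contract (h : AgreeNear x₀ τ σ) {j : ℕ} {X Y : MultiVec E M j}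
    (hX : ∀ᶠ x in 𝓝 x₀, X.1 x = Y.1 x) :
    AgreeNear x₀ (contract X τ) (contract Y σ) := by
  filter_upwards [h, hX] with x hx hXx p
  rw [contract_apply_apply, contract_apply_apply, hXx, funext hx]

end AgreeNear

end Locality

section Extension

variable {E : Type*} [NormedAddCommGroup E] [NormedSpace ℝ E]
  {M : Type*} [TopologicalSpace M] [ChartedSpace E M]

/-- The `p`-form with constant coefficients `a` in the chart at `x₀`; its values outside the domain
of that chart are not meaningful. -/
def chartConstForm {p : ℕ} (x₀ : M) (a : E [⋀^Fin p]→L[ℝ] ℝ) (x : M) :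
    TangentSpace 𝓘(ℝ, E) x [⋀^Fin p]→L[ℝ] ℝ :=
  a.compContinuousLinearMap (mfderiv 𝓘(ℝ, E) 𝓘(ℝ, E) (extChartAt 𝓘(ℝ, E) x₀) x :)

variable [IsManifold 𝓘(ℝ, E) ∞ M]

theorem chartRep_chartConstForm {p : ℕ} {x₀ x₁ : M} (a : E [⋀^Fin p]→L[ℝ] ℝ) {y : E}
    (hy : y ∈ (extChartAt 𝓘(ℝ, E) x₁).target)
    (hy' : (extChartAt 𝓘(ℝ, E) x₁).symm y ∈ (extChartAt 𝓘(ℝ, E) x₀).source) :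
    chartRep x₁ (chartConstForm x₀ a) y = a.compContinuousLinearMap
      (fderiv ℝ (extChartAt 𝓘(ℝ, E) x₀ ∘ (extChartAt 𝓘(ℝ, E) x₁).symm) y) := by
  have hchart : MDifferentiableAt 𝓘(ℝ, E) 𝓘(ℝ, E) (extChartAt 𝓘(ℝ, E) x₀)
      ((extChartAt 𝓘(ℝ, E) x₁).symm y) :=
    (contMDiffAt_extChartAt' (n := ∞) (by simpa using hy')).mdifferentiableAt (by simp)
  have hsymm : MDifferentiableAt 𝓘(ℝ, E) 𝓘(ℝ, E) (extChartAt 𝓘(ℝ, E) x₁).symm y :=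
    ((contMDiffOn_extChartAt_symm (I := 𝓘(ℝ, E)) (n := ∞) x₁).contMDiffAt
      ((isOpen_extChartAt_target (I := 𝓘(ℝ, E)) x₁).mem_nhds hy)).mdifferentiableAt (by simp)
  rw [← mfderiv_eq_fderiv, mfderiv_comp y hchart hsymm]
  rfl

variable [FiniteDimensional ℝ E]

theorem contDiffAt_chartRep_chartConstForm {p : ℕ} {x₀ x₁ : M} (a : E [⋀^Fin p]→L[ℝ] ℝ)
    (hx₁ : x₁ ∈ (extChartAt 𝓘(ℝ, E) x₀).source) :
    ContDiffAt ℝ ∞ (chartRep x₁ (chartConstForm x₀ a)) (extChartAt 𝓘(ℝ, E) x₁ x₁) := by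
  have hy := mem_extChartAt_target (I := 𝓘(ℝ, E)) x₁
  rw [← extChartAt_to_inv (I := 𝓘(ℝ, E)) x₁] at hx₁
  refine (contDiffAt_comp_fderiv (F := fun _ => a) contDiffAt_const
    (contDiffAt_transition x₁ x₀ hy hx₁)).congr_of_eventuallyEq ?_
  filter_upwards [eventually_mem_source x₁ x₀ hy hx₁] with z hz
  exact chartRep_chartConstForm a hz.1 hz.2

theorem contMDiff_smul_chartConstForm {p : ℕ} (x₀ : M) {ψ : M → ℝ}
    (hψ : ContMDiff 𝓘(ℝ, E) 𝓘(ℝ) ∞ ψ) (hs : tsupport ψ ⊆ (extChartAt 𝓘(ℝ, E) x₀).source)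
    (a : E [⋀^Fin p]→L[ℝ] ℝ) :
    ContMDiff 𝓘(ℝ, E) (𝓘(ℝ, E).prod 𝓘(ℝ, E [⋀^Fin p]→L[ℝ] ℝ)) ∞
      (fun x => Bundle.TotalSpace.mk' (E [⋀^Fin p]→L[ℝ] ℝ)
        (E := fun x : M => TangentSpace 𝓘(ℝ, E) x [⋀^Fin p]→L[ℝ] Bundle.Trivial M ℝ x)
        x (ψ x • chartConstForm x₀ a x)) := by
  refine (contMDiff_iff_chartRep _).2 fun x₁ => ?_
  by_cases hx₁ : x₁ ∈ (extChartAt 𝓘(ℝ, E) x₀).source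
  · refine ContDiffAt.smul (f := ψ ∘ (extChartAt 𝓘(ℝ, E) x₁).symm) ?_
      (contDiffAt_chartRep_chartConstForm a hx₁)
    exact contMDiffAt_iff_contDiffAt.1 (hψ.contMDiffAt.comp _
      ((contMDiffOn_extChartAt_symm (I := 𝓘(ℝ, E)) (n := ∞) x₁).contMDiffAt
        ((isOpen_extChartAt_target (I := 𝓘(ℝ, E)) x₁).mem_nhds (mem_extChartAt_target x₁))))
  · have hψ_zero : ψ =ᶠ[𝓝 x₁] 0 := notMem_tsupport_iff_eventuallyEq.1 fun h => hx₁ (hs h)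
    refine contDiffAt_const (c := 0) |>.congr_of_eventuallyEq ?_
    filter_upwards [(tendsto_extChartAt_symm x₁).eventually hψ_zero] with y hy
    ext w
    exact (congrArg (· * _) hy).trans (zero_mul _)

theorem Form.exists_apply_eq [T2Space M] {p : ℕ} (x₀ : M)
    (a : TangentSpace 𝓘(ℝ, E) x₀ [⋀^Fin p]→L[ℝ] ℝ) : ∃ τ : Form E M p, τ x₀ = a := by
  let ψ : SmoothBumpFunction 𝓘(ℝ, E) x₀ := Classical.choice inferInstance
  let D : TangentSpace 𝓘(ℝ, E) x₀ →L[ℝ] E := mfderiv 𝓘(ℝ, E) 𝓘(ℝ, E) (extChartAt 𝓘(ℝ, E) x₀) x₀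
  refine ⟨⟨fun x => ψ x • chartConstForm x₀ (a.compContinuousLinearMap D.inverse) x,
    contMDiff_smul_chartConstForm x₀ ψ.contMDiff ψ.tsupport_subset_extChartAt_source _⟩, ?_⟩
  ext w
  change ψ x₀ * a (fun i => D.inverse (D (w i))) = a w
  have hD : D.IsInvertible := isInvertible_mfderiv_extChartAt (mem_extChartAt_source x₀)
  simp only [ψ.eq_one, one_mul, hD.inverse_apply_self]

theorem eq_of_contractAt_eq [T2Space M] {x : M} {X Y : ExteriorAlgebra ℝ (TangentSpace 𝓘(ℝ, E) x)}
    (h : ∀ (τ : Forms E M) (q : ℕ),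
      contractAt X (fun p => τ p x) q = contractAt Y (fun p => τ p x) q) : X = Y := by
  refine eq_of_forall_pairing_eq fun a => ?_
  choose τ hτ using fun p => Form.exists_apply_eq x (a p)
  obtain rfl : (fun p => τ p x) = a := funext hτ
  have h0 := congrArg (fun b => b ![]) (h τ 0)
  simpa only [contractAt_apply, ExteriorAlgebra.ιMulti_zero_apply, mul_one] using h0

theorem contract_injective [T2Space M] {j : ℕ} :
    Function.Injective (contract : MultiVec E M j → Module.End ℝ (Forms E M)) := by
  intro X Y h
  refine Subtype.ext (funext fun x => eq_of_contractAt_eq fun τ q => ?_)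
  rw [← contract_apply_apply, ← contract_apply_apply, h]

end Extension

section Bilinear

theorem map₂_list_sum {R A B C ι κ : Type*} [CommSemiring R] [AddCommMonoid A] [AddCommMonoid B]
    [AddCommMonoid C] [Module R A] [Module R B] [Module R C] (f : A →ₗ[R] B →ₗ[R] C)
    (l : List ι) (m : List κ) (a : ι → A) (b : κ → B) :
    f (l.map a).sum (m.map b).sum = (l.map fun s => (m.map fun t => f (a s) (b t)).sum).sum := by
  rw [← f.flip_apply, map_list_sum, List.map_map]
  simp only [Function.comp_def, LinearMap.flip_apply, map_list_sum (f _), List.map_map]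

variable (𝕜 : Type*) {R : Type*} [CommRing 𝕜] [Ring R] [Algebra 𝕜 R]

/-- `derivedBracket` as a bilinear map. -/
def derivedBracketₗ (d : R) (i j : ℕ) : R →ₗ[𝕜] R →ₗ[𝕜] R :=
  LinearMap.mk₂ 𝕜 (derivedBracket 𝕜 d i j)
    (fun x x' y => by
      simp only [derivedBracket, gradedCommutator, add_mul, mul_add, smul_add, sub_mul, mul_sub]
      module)
    (fun c x y => by
      simp only [derivedBracket, gradedCommutator, sub_mul, mul_sub, mul_smul_comm, smul_mul_assoc]
      module)
    (fun x y y' => by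
      simp only [derivedBracket, add_mul, mul_add]
      module)
    (fun c x y => by
      simp only [derivedBracket, mul_smul_comm, smul_mul_assoc]
      module)

end Bilinear

section Schouten

variable {E : Type*} [NormedAddCommGroup E] [NormedSpace ℝ E] [FiniteDimensional ℝ E]
  {M : Type*} [TopologicalSpace M] [ChartedSpace E M] [IsManifold 𝓘(ℝ, E) ∞ M] {i j : ℕ}

/-- The value at a point of a multivector field, as a linear map. -/
def MultiVec.evalₗ (x : M) :
    MultiVec E M j →ₗ[ℝ] ExteriorAlgebra ℝ (TangentSpace 𝓘(ℝ, E) x) where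
  toFun X := X.1 x
  map_add' _ _ := rfl
  map_smul' _ _ := rfl

theorem MultiVec.evalₗ_apply (x : M) (X : MultiVec E M j) : evalₗ x X = X.1 x := rfl

theorem sum_wedgeField_apply (l : List (Fin (j + 1) → VecField E M)) (x : M) :
    (l.map wedgeField).sum.1 x = (l.map fun V => wedge V x).sum := by
  rw [← MultiVec.evalₗ_apply, map_list_sum, List.map_map]
  rfl

/-- The Schouten bracket of two wedges of vector fields, as a smooth multivector field. -/
def schoutenWedgeField (V : Fin (i + 1) → VecField E M) (W : Fin (j + 1) → VecField E M) :
    MultiVec E M (i + j) :=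
  ∑ a : Fin (i + 1), ∑ b : Fin (j + 1), (-1 : ℝ) ^ (a + b : ℕ) •
    wedgeField (Fin.cons ((V a).bracket (W b)) (Fin.append (a.removeNth V) (b.removeNth W)))

theorem schoutenWedgeField_apply (V : Fin (i + 1) → VecField E M) (W : Fin (j + 1) → VecField E M)
    (x : M) : (schoutenWedgeField V W).1 x = schoutenWedge V W x := by
  rw [← MultiVec.evalₗ_apply, schoutenWedgeField]
  simp only [map_sum, map_smul, schoutenWedge]
  refine Finset.sum_congr rfl fun a _ => Finset.sum_congr rfl fun b _ => ?_
  congr 1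
  simp only [MultiVec.evalₗ_apply, wedgeField, wedge]
  rw [ExteriorAlgebra.ιMulti_succ_apply, mul_assoc, ExteriorAlgebra.ιMulti_mul_ιMulti]
  congr 2
  funext s
  cases s using Fin.addCases <;> simp [Matrix.vecTail, Fin.removeNth]

theorem contract_schoutenWedgeField (V : Fin (i + 1) → VecField E M)
    (W : Fin (j + 1) → VecField E M) : contract (schoutenWedgeField V W) =
      derivedBracket ℝ Forms.d i j (contract (wedgeField V)) (contract (wedgeField W)) := by
  have hVW (V W : VecField E M) :
      derivedBracket ℝ Forms.d 0 0 (insertVec V) (insertVec W) = insertVec (V.bracket W) := by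
    rw [← gradedCommutator_insertVec_mul_sub]
    simp [derivedBracket]
  rw [contract_wedgeField, contract_wedgeField,
    derivedBracket_revProd ℝ (fun _ _ => insertVec_mul_insertVec _ _) (fun _ _ => hVW _ _)
      (fun _ _ _ => insertVec_mul_insertVec _ _) (fun _ _ _ => insertVec_mul_insertVec _ _),
    schoutenWedgeField]
  simp only [map_sum, map_smul, contract_wedgeField]
  refine Finset.sum_congr rfl fun a _ => Finset.sum_congr rfl fun b _ => ?_
  congr 1
  rw [revProd_succ, ← mul_assoc, ← revProd_append]
  congr 2
  funext s
  cases s using Fin.addCases <;> simp [Fin.tail, Fin.removeNth]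

/-- The Schouten bracket of two sums of wedges of vector fields. -/
def schoutenSum (l : List (Fin (i + 1) → VecField E M)) (m : List (Fin (j + 1) → VecField E M)) :
    MultiVec E M (i + j) :=
  (l.map fun V => (m.map fun W => schoutenWedgeField V W).sum).sum

theorem schoutenSum_apply (l : List (Fin (i + 1) → VecField E M))
    (m : List (Fin (j + 1) → VecField E M)) (x : M) :
    (schoutenSum l m).1 x = (l.map fun V => (m.map fun W => schoutenWedge V W x).sum).sum := by
  rw [← MultiVec.evalₗ_apply, schoutenSum]
  simp only [map_list_sum, List.map_map, Function.comp_def, MultiVec.evalₗ_apply,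
    schoutenWedgeField_apply]

variable (E M i j) in
/-- The operator by which the Schouten bracket of two multivector fields contracts, as a bilinear
function of them. -/
def schoutenOp : MultiVec E M i →ₗ[ℝ] MultiVec E M j →ₗ[ℝ] Module.End ℝ (Forms E M) :=
  (derivedBracketₗ ℝ Forms.d i j).compl₁₂ contract contract

theorem schoutenOp_apply (X : MultiVec E M i) (Y : MultiVec E M j) :
    schoutenOp E M i j X Y = derivedBracket ℝ Forms.d i j (contract X) (contract Y) := rfl

theorem schoutenOp_apply_apply (X : MultiVec E M i) (Y : MultiVec E M j) (τ : Forms E M) :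
    schoutenOp E M i j X Y τ =
      (-1 : ℝ) ^ (i * (j + 1)) • lieDeriv X (contract Y τ) - contract Y (lieDeriv X τ) := rfl

theorem contract_schoutenSum (l : List (Fin (i + 1) → VecField E M))
    (m : List (Fin (j + 1) → VecField E M)) : contract (schoutenSum l m) =
      schoutenOp E M i j (l.map wedgeField).sum (m.map wedgeField).sum := by
  rw [map₂_list_sum]
  simp only [schoutenOp_apply, ← contract_schoutenWedgeField, schoutenSum, map_list_sum,
    List.map_map, Function.comp_def]

theorem AgreeNear.schoutenOp {x₀ : M} {X X' : MultiVec E M i} {Y Y' : MultiVec E M j}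
    (hX : ∀ᶠ x in 𝓝 x₀, X.1 x = X'.1 x) (hY : ∀ᶠ x in 𝓝 x₀, Y.1 x = Y'.1 x) (τ : Forms E M) :
    AgreeNear x₀ (schoutenOp E M i j X Y τ) (schoutenOp E M i j X' Y' τ) := by
  have hτ : AgreeNear x₀ τ τ := Eventually.of_forall fun _ _ => rfl
  have hlie {σ σ' : Forms E M} (h : AgreeNear x₀ σ σ') :
      AgreeNear x₀ (lieDeriv X σ) (lieDeriv X' σ') := by
    rw [lieDeriv_apply, lieDeriv_apply]
    exact (h.contract hX).d.sub ((h.d.contract hX).smul _)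
  rw [schoutenOp_apply_apply, schoutenOp_apply_apply]
  exact ((hlie (hτ.contract hY)).smul _).sub ((hlie hτ).contract hY)

theorem schoutenOp_apply_apply_apply {X : MultiVec E M i} {Y : MultiVec E M j} {x₀ : M}
    {l : List (Fin (i + 1) → VecField E M)} {m : List (Fin (j + 1) → VecField E M)}
    (hl : ∀ᶠ x in 𝓝 x₀, X.1 x = (l.map fun V => wedge V x).sum)
    (hm : ∀ᶠ x in 𝓝 x₀, Y.1 x = (m.map fun W => wedge W x).sum) (τ : Forms E M) (q : ℕ) :
    schoutenOp E M i j X Y τ q x₀ =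
      contractAt ((schoutenSum l m).1 x₀) (fun p => τ p x₀) q := by
  rw [← contract_apply_apply, contract_schoutenSum]
  simp only [← sum_wedgeField_apply] at hl hm
  exact (AgreeNear.schoutenOp hl hm τ).eq q

variable [T2Space M]

theorem exists_contract_eq_schoutenOp (X : MultiVec E M i) (Y : MultiVec E M j) :
    ∃ Z : MultiVec E M (i + j), contract Z = schoutenOp E M i j X Y := by
  choose l hl using X.2
  choose m hm using Y.2
  have hmem : (fun x => (schoutenSum (l x) (m x)).1 x) ∈ MultiVec E M (i + j) := by
    intro x₀
    obtain ⟨r, hr⟩ := (schoutenSum (l x₀) (m x₀)).2 x₀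
    refine ⟨r, ?_⟩
    filter_upwards [hr, (hl x₀).eventually_nhds, (hm x₀).eventually_nhds] with x hx hlx hmx
    refine Eq.trans (eq_of_contractAt_eq fun τ q => ?_) hx
    rw [← schoutenOp_apply_apply_apply (hl x) (hm x),
      ← schoutenOp_apply_apply_apply hlx hmx]
  exact ⟨⟨_, hmem⟩, LinearMap.ext fun τ => Forms.ext fun q x =>
    (schoutenOp_apply_apply_apply (hl x) (hm x) τ q).symm⟩

theorem exists_bilinear_contract_eq_schoutenOp (i j : ℕ) :
    ∃ br : MultiVec E M i →ₗ[ℝ] MultiVec E M j →ₗ[ℝ] MultiVec E M (i + j),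
      ∀ X Y, contract (br X Y) = schoutenOp E M i j X Y := by
  choose br hbr using exists_contract_eq_schoutenOp (E := E) (M := M) (i := i) (j := j)
  refine ⟨LinearMap.mk₂ ℝ br (fun _ _ _ => ?_) (fun _ _ _ => ?_) (fun _ _ _ => ?_)
    (fun _ _ _ => ?_), hbr⟩ <;>
  refine contract_injective ?_ <;>
  simp only [hbr, map_add, map_smul, LinearMap.add_apply, LinearMap.smul_apply]

/-- The Schouten bracket, characterized by `contract_schouten`. -/
def schouten (i j : ℕ) : MultiVec E M i →ₗ[ℝ] MultiVec E M j →ₗ[ℝ] MultiVec E M (i + j) :=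
  (exists_bilinear_contract_eq_schoutenOp i j).choose

theorem contract_schouten (X : MultiVec E M i) (Y : MultiVec E M j) :
    contract (schouten i j X Y) = derivedBracket ℝ Forms.d i j (contract X) (contract Y) :=
  (exists_bilinear_contract_eq_schoutenOp i j).choose_spec X Y

theorem isSchoutenBracket_schouten : IsSchoutenBracket (schouten (E := E) (M := M)) := by
  intro i j X Y x₀ l m hl hm
  rw [← schoutenSum_apply]
  refine eq_of_contractAt_eq fun τ q => ?_
  rw [← contract_apply_apply, contract_schouten, ← schoutenOp_apply,
    schoutenOp_apply_apply_apply hl hm]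

end Schouten

section GradedLie

variable {L L' : ℕ → Type*} [∀ i, AddCommGroup (L i)] [∀ i, Module ℝ (L i)]
  [∀ i, AddCommGroup (L' i)] [∀ i, Module ℝ (L' i)]
  {br : ∀ i j : ℕ, L i →ₗ[ℝ] L j →ₗ[ℝ] L (i + j)}
  {br' : ∀ i j : ℕ, L' i →ₗ[ℝ] L' j →ₗ[ℝ] L' (i + j)}

theorem IsGradedLieBracket.of_injective (h : IsGradedLieBracket br) (f : ∀ j, L' j →ₗ[ℝ] L j)
    (hf : ∀ j, Function.Injective (f j))
    (hbr : ∀ i j x y, f (i + j) (br' i j x y) = br i j (f i x) (f j y)) :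
    IsGradedLieBracket br' := by
  have hinj := (DirectSum.lmap_injective (f := f)).2 hf
  refine ⟨fun i j x y => hinj ?_, fun i j k x y z => hinj ?_⟩
  · simp only [map_neg, map_smul, DirectSum.lmap_of, hbr]
    exact h.1 i j _ _
  · simp only [map_add, map_smul, DirectSum.lmap_of, hbr, map_zero]
    exact h.2 i j k _ _ _

theorem IsGradedLieBracket.of_surjective (h : IsGradedLieBracket br') (f : ∀ j, L' j →ₗ[ℝ] L j)
    (hf : ∀ j, Function.Surjective (f j))
    (hbr : ∀ i j x y, f (i + j) (br' i j x y) = br i j (f i x) (f j y)) :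
    IsGradedLieBracket br := by
  refine ⟨fun i j => (hf i).forall.2 fun x => (hf j).forall.2 fun y => ?_,
    fun i j k => (hf i).forall.2 fun x => (hf j).forall.2 fun y => (hf k).forall.2 fun z => ?_⟩
  · have := congrArg (DirectSum.lmap f) (h.1 i j x y)
    simpa only [map_neg, map_smul, DirectSum.lmap_of, hbr] using this
  · have := congrArg (DirectSum.lmap f) (h.2 i j k x y z)
    simpa only [map_add, map_smul, DirectSum.lmap_of, hbr, map_zero] using this

theorem eq_zero_of_mem_range_lof {A : Type*} [AddCommGroup A] [Module ℝ A] {ρ : ∀ j, L j →ₗ[ℝ] A}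
    {n : ℕ} (hρ : Function.Injective (ρ n)) {z : DirectSum ℕ L}
    (hz : z ∈ LinearMap.range (DirectSum.lof ℝ ℕ L n)) (h : DirectSum.toModule ℝ ℕ A ρ z = 0) :
    z = 0 := by
  obtain ⟨x, rfl⟩ := hz
  rw [DirectSum.toModule_lof] at h
  rw [(map_eq_zero_iff _ hρ).1 h, map_zero]

theorem of_mem_range_lof {m n : ℕ} (h : m = n) (x : L m) :
    DirectSum.of L m x ∈ LinearMap.range (DirectSum.lof ℝ ℕ L n) := h ▸ ⟨x, rfl⟩

theorem isGradedLieBracket_of_injective {A : Type*} [AddCommGroup A] [Module ℝ A]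
    (ρ : ∀ j, L j →ₗ[ℝ] A) (hρ : ∀ j, Function.Injective (ρ j))
    (skew : ∀ i j x y, ρ (i + j) (br i j x y) = -((-1 : ℝ) ^ (i * j) • ρ (j + i) (br j i y x)))
    (jacobi : ∀ i j k x y z,
      (-1 : ℝ) ^ (i * k) • ρ (i + (j + k)) (br i (j + k) x (br j k y z)) +
      (-1 : ℝ) ^ (j * i) • ρ (j + (k + i)) (br j (k + i) y (br k i z x)) +
      (-1 : ℝ) ^ (k * j) • ρ (k + (i + j)) (br k (i + j) z (br i j x y)) = 0) :
    IsGradedLieBracket br := by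
  have hof (n : ℕ) (x : L n) : DirectSum.toModule ℝ ℕ A ρ (DirectSum.of L n x) = ρ n x :=
    DirectSum.toModule_lof ℝ n x
  constructor
  · intro i j x y
    rw [← sub_eq_zero]
    refine eq_zero_of_mem_range_lof (hρ (i + j)) (sub_mem (of_mem_range_lof rfl _)
      (neg_mem (Submodule.smul_mem _ _ (of_mem_range_lof (add_comm j i) _)))) ?_
    rw [map_sub, map_neg, map_smul, hof, hof, skew, sub_self]
  · intro i j k x y z
    refine eq_zero_of_mem_range_lof (hρ (i + (j + k))) (add_mem (add_mem ?_ ?_) ?_) ?_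
    · exact Submodule.smul_mem _ _ (of_mem_range_lof rfl _)
    · exact Submodule.smul_mem _ _ (of_mem_range_lof (by omega) _)
    · exact Submodule.smul_mem _ _ (of_mem_range_lof (by omega) _)
    · simp only [map_add, map_smul, hof, jacobi]

end GradedLie

section

variable {E : Type*} [NormedAddCommGroup E] [NormedSpace ℝ E] [FiniteDimensional ℝ E]
  {M : Type*} [TopologicalSpace M] [T2Space M] [ChartedSpace E M] [IsManifold 𝓘(ℝ, E) ∞ M]

theorem isGradedLieBracket_schouten :
    IsGradedLieBracket (L := fun j => MultiVec E M j) schouten := by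
  refine isGradedLieBracket_of_injective (fun _ => contract) (fun _ => contract_injective)
    (fun i j X Y => ?_) fun i j k X Y Z => ?_
  · rw [contract_schouten, contract_schouten]
    exact derivedBracket_skew ℝ Forms.d (contract_mul_contract X Y)
  · simp only [contract_schouten]
    refine derivedBracket_jacobi ℝ Forms.d_mul_d (contract_mul_contract Z X) ?_
    rw [← contract_schouten]
    exact contract_mul_contract Z (schouten i j X Y)

theorem lieDeriv_schouten {i j : ℕ} (X : MultiVec E M i) (Y : MultiVec E M j) (τ : Forms E M) :
    lieDeriv (schouten i j X Y) τ =
      (-1 : ℝ) ^ (i * j) • lieDeriv X (lieDeriv Y τ) - lieDeriv Y (lieDeriv X τ) := by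
  have h := gradedCommutator_derivedBracket ℝ Forms.d_mul_d i j (contract X) (contract Y)
  rw [← contract_schouten] at h
  exact LinearMap.congr_fun h τ

end

section Quotients

variable {R A B F : Type*} [Ring R] [AddCommGroup A] [AddCommGroup B] [AddCommGroup F]
  [Module R A] [Module R B] [Module R F] {f : A →ₗ[R] F} {g : B →ₗ[R] F} {p : Submodule R A}
  {q : Submodule R B}

/-- The isomorphism of the quotients by the kernels `p` and `q` of two linear maps `f` and `g` with
the same range, which identifies the classes of `a` and `b` if `f a = g b`. -/
def quotEquivOfRangeEq (hp : p = LinearMap.ker f) (hq : q = LinearMap.ker g)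
    (h : LinearMap.range f = LinearMap.range g) : (A ⧸ p) ≃ₗ[R] B ⧸ q :=
  (Submodule.quotEquivOfEq _ _ hp ≪≫ₗ f.quotKerEquivRange) ≪≫ₗ LinearEquiv.ofEq _ _ h ≪≫ₗ
    (Submodule.quotEquivOfEq _ _ hq ≪≫ₗ g.quotKerEquivRange).symm

theorem quotEquivOfRangeEq_mk (hp : p = LinearMap.ker f) (hq : q = LinearMap.ker g)
    (h : LinearMap.range f = LinearMap.range g) {a : A} {b : B} (hab : f a = g b) :
    quotEquivOfRangeEq hp hq h (Submodule.Quotient.mk a) = Submodule.Quotient.mk b := by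
  rw [quotEquivOfRangeEq, LinearEquiv.trans_apply, LinearEquiv.trans_apply,
    LinearEquiv.symm_apply_eq]
  exact Subtype.ext hab

end Quotients

section Systems

variable {E : Type*} [NormedAddCommGroup E] [NormedSpace ℝ E] [FiniteDimensional ℝ E]
  {M : Type*} [TopologicalSpace M] [ChartedSpace E M] [IsManifold 𝓘(ℝ, E) ∞ M] {i j : ℕ}

theorem Forms.d_of_eq_zero {p : ℕ} {τ : Form E M p} (h : Form.d τ = 0) :
    Forms.d (Forms.of τ) = 0 := by
  funext q
  cases q with
  | zero => rfl
  | succ q =>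
    change Form.d (Pi.single (M := fun p => Form E M p) p τ q) = 0
    by_cases hq : q = p
    · subst hq
      rw [Pi.single_eq_same, h]
    · rw [Pi.single_eq_of_ne hq, map_zero]

theorem Kind.range_d_le_forms {t : Kind} (ht : t = Kind.glob ∨ t = Kind.loc) :
    LinearMap.range (Forms.d (E := E) (M := M)) ≤ t.forms := by
  rcases ht with rfl | rfl
  · exact le_rfl
  · rintro _ ⟨σ, rfl⟩
    exact Forms.d_d σ

theorem lieDeriv_mem_forms (t : Kind) (X : MultiVec E M j) {θ : Forms E M} (hθ : θ ∈ t.forms) :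
    lieDeriv X θ ∈ t.forms := by
  cases t with
  | loc =>
    have hθ : Forms.d θ = 0 := hθ
    change Forms.d (lieDeriv X θ) = 0
    rw [lieDeriv_apply, hθ, map_zero, smul_zero, sub_zero, Forms.d_d]
  | glob =>
    obtain ⟨σ, rfl⟩ := hθ
    refine ⟨contract X (Forms.d σ), ?_⟩
    rw [lieDeriv_apply, Forms.d_d, map_zero, smul_zero, sub_zero]
  | str =>
    obtain rfl : θ = 0 := hθ
    rw [map_zero]
    exact zero_mem _

namespace MultiHamiltonianSystem

variable {n : ℕ} (sys : MultiHamiltonianSystem E M n) {t : Kind}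

theorem d_plecticForm : Forms.d sys.plecticForm = 0 := Forms.d_of_eq_zero sys.closed

theorem contract_XH_plecticForm :
    contract sys.XH sys.plecticForm = -Forms.d sys.hamiltonianForm :=
  neg_eq_iff_eq_neg.1 sys.hamiltonian.symm

theorem plecticForm_apply_of_ne {p : ℕ} (h : p ≠ n + 1) : sys.plecticForm p = 0 :=
  Pi.single_eq_of_ne (M := fun p => Form E M p) h _

theorem contract_plecticForm_apply_of_ne (X : MultiVec E M j) {p : ℕ} (h : p + j ≠ n) :
    contract X sys.plecticForm p = 0 :=
  contract_apply_eq_zero _ (sys.plecticForm_apply_of_ne (by omega))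

theorem poissonBracket_apply_of_ne (X : MultiVec E M i) (Y : MultiVec E M j) {p : ℕ}
    (hp : p + (i + j + 1) ≠ n) : sys.poissonBracket X Y p = 0 := by
  rw [poissonBracket, Forms.smul_apply,
    contract_apply_eq_zero _ (sys.contract_plecticForm_apply_of_ne X (by omega))]
  exact smul_zero (A := Form E M p) ((-1 : ℝ) ^ (j + 1 + 1))

theorem d_contract_plecticForm {X : MultiVec E M j} (hX : X ∈ sys.hamiltonianFields j) :
    Forms.d (contract X sys.plecticForm) = 0 := by
  obtain ⟨σ, hσ⟩ := hX
  rw [← hσ, Forms.d_d]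

theorem contract_schouten_plecticForm [T2Space M] {X : MultiVec E M i} {Y : MultiVec E M j}
    (hX : X ∈ sys.hamiltonianFields i) (hY : Y ∈ sys.hamiltonianFields j) :
    contract (schouten i j X Y) sys.plecticForm =
      (-1 : ℝ) ^ (j + 1) • Forms.d (contract Y (contract X sys.plecticForm)) := by
  rw [contract_schouten, ← schoutenOp_apply, schoutenOp_apply_apply, lieDeriv_apply,
    lieDeriv_apply, sys.d_plecticForm, sys.d_contract_plecticForm hX,
    sys.d_contract_plecticForm hY, contract_contract X Y]
  simp only [map_zero, smul_zero, sub_zero, map_smul, smul_smul, ← pow_add]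
  congr 1
  rw [← add_mul, pow_mul, Odd.neg_one_pow ⟨i, by ring⟩]

theorem schouten_mem_hamiltonianFields [T2Space M] {X : MultiVec E M i} {Y : MultiVec E M j}
    (hX : X ∈ sys.hamiltonianFields i) (hY : Y ∈ sys.hamiltonianFields j) :
    schouten i j X Y ∈ sys.hamiltonianFields (i + j) :=
  ⟨(-1 : ℝ) ^ (j + 1) • contract Y (contract X sys.plecticForm), by
    rw [map_smul, sys.contract_schouten_plecticForm hX hY]⟩

theorem schouten_mem_symmetries [T2Space M] {X : MultiVec E M i} {Y : MultiVec E M j}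
    (hX : X ∈ sys.symmetries t i) (hY : Y ∈ sys.symmetries t j) :
    schouten i j X Y ∈ sys.symmetries t (i + j) := by
  refine ⟨sys.schouten_mem_hamiltonianFields hX.1 hY.1, ?_⟩
  rw [lieDeriv_schouten]
  exact sub_mem (Submodule.smul_mem _ _ (lieDeriv_mem_forms t X hY.2))
    (lieDeriv_mem_forms t Y hX.2)

theorem isHamiltonianField_poissonBracket [T2Space M] {X : MultiVec E M i} {Y : MultiVec E M j}
    (hX : X ∈ sys.hamiltonianFields i) (hY : Y ∈ sys.hamiltonianFields j) :
    sys.IsHamiltonianField (sys.poissonBracket X Y) (schouten i j X Y) := by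
  rw [IsHamiltonianField, poissonBracket, sys.contract_schouten_plecticForm hX hY, map_smul,
    pow_succ, mul_neg_one, neg_smul]

theorem lieDeriv_add_lieDeriv_mem_range_d {α : Forms E M} {X : MultiVec E M j}
    (h : sys.IsHamiltonianField α X) :
    lieDeriv sys.XH α + lieDeriv X sys.hamiltonianForm ∈ LinearMap.range (Forms.d (E := E)) := by
  refine ⟨contract sys.XH α + contract X sys.hamiltonianForm, ?_⟩
  rw [lieDeriv_apply, lieDeriv_apply, h, map_neg, contract_contract, contract_XH_plecticForm]
  simp only [map_add, map_neg, zero_add, one_mul, pow_one, neg_smul, one_smul, smul_neg, neg_neg]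
  abel

theorem mem_symmetries_of_mem_conserved
    (ht : LinearMap.range (Forms.d (E := E) (M := M)) ≤ t.forms) {α : Forms E M}
    {X : MultiVec E M j} (hα : α ∈ sys.conserved t j) (h : sys.IsHamiltonianField α X) :
    X ∈ sys.symmetries t j :=
  ⟨⟨-α, by rw [map_neg, h, neg_neg]⟩, (Submodule.add_mem_iff_right _ hα.2.2).1
    (ht (sys.lieDeriv_add_lieDeriv_mem_range_d h))⟩

theorem mem_conserved_of_mem_symmetries
    (ht : LinearMap.range (Forms.d (E := E) (M := M)) ≤ t.forms) {α : Forms E M}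
    {X : MultiVec E M j} (hX : X ∈ sys.symmetries t j) (h : sys.IsHamiltonianField α X)
    (hα : ∀ p, p + (j + 1) ≠ n → α p = 0) : α ∈ sys.conserved t j :=
  ⟨hα, ⟨X, h⟩, (Submodule.add_mem_iff_left _ hX.2).1
    (ht (sys.lieDeriv_add_lieDeriv_mem_range_d h))⟩

theorem poissonBracket_mem_conserved [T2Space M]
    (ht : LinearMap.range (Forms.d (E := E) (M := M)) ≤ t.forms)
    {X : MultiVec E M i} {Y : MultiVec E M j} (hX : X ∈ sys.symmetries t i)
    (hY : Y ∈ sys.symmetries t j) : sys.poissonBracket X Y ∈ sys.conserved t (i + j) :=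
  sys.mem_conserved_of_mem_symmetries ht (sys.schouten_mem_symmetries hX hY)
    (sys.isHamiltonianField_poissonBracket hX.1 hY.1)
    fun _ => sys.poissonBracket_apply_of_ne X Y

theorem exists_isHamiltonianField {X : MultiVec E M j} (hX : X ∈ sys.hamiltonianFields j) :
    ∃ α : Forms E M, (∀ p, p + (j + 1) ≠ n → α p = 0) ∧ sys.IsHamiltonianField α X := by
  obtain ⟨σ, hσ⟩ := hX
  -- `X ⌟ ω` is homogeneous, so one component of its primitive `σ` is a primitive already.
  classical
  refine ⟨fun p => if p + (j + 1) = n then -σ p else 0, fun p hp => if_neg hp, ?_⟩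
  refine Eq.trans ?_ (congrArg Neg.neg hσ)
  funext q
  cases q with
  | zero => exact (neg_zero (G := Form E M 0)).symm
  | succ p =>
    change Form.d (if p + (j + 1) = n then -σ p else 0) = -Form.d (σ p)
    split_ifs with hp
    · exact map_neg Form.d (σ p)
    · have hσp : Form.d (σ p) = 0 := (congrFun hσ (p + 1)).trans
        (sys.contract_plecticForm_apply_of_ne X (by omega))
      rw [hσp, map_zero, neg_zero]

/-- The map `X ↦ -X ⌟ ω` on symmetries, which takes the values `dα` for the conserved quantities
`α`. -/
def symmetriesToForms (t : Kind) (j : ℕ) :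
    sys.symmetries t j →ₗ[ℝ] Forms E M :=
  -(contract.flip sys.plecticForm).domRestrict (sys.symmetries t j)

theorem range_d_domRestrict_conserved (ht : LinearMap.range (Forms.d (E := E) (M := M)) ≤ t.forms) :
    LinearMap.range (Forms.d.domRestrict (sys.conserved t j)) =
      LinearMap.range (sys.symmetriesToForms t j) := by
  refine le_antisymm ?_ ?_
  · rintro _ ⟨⟨α, hα⟩, rfl⟩
    obtain ⟨X, hX⟩ := hα.2.1
    exact ⟨⟨X, sys.mem_symmetries_of_mem_conserved ht hα hX⟩, hX.symm⟩
  · rintro _ ⟨⟨X, hX⟩, rfl⟩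
    obtain ⟨α, hα, hαX⟩ := sys.exists_isHamiltonianField hX.1
    exact ⟨⟨α, sys.mem_conserved_of_mem_symmetries ht hX hαX hα⟩, hαX⟩

theorem kernel_submoduleOf_symmetries :
    (sys.kernel j).submoduleOf (sys.symmetries t j) =
      LinearMap.ker (sys.symmetriesToForms t j) := by
  rw [symmetriesToForms, LinearMap.ker_neg]
  rfl

/-- The isomorphism `[α] ↦ [X_α]`. -/
def conservedQuotEquiv (ht : LinearMap.range (Forms.d (E := E) (M := M)) ≤ t.forms) (j : ℕ) :
    sys.ConservedQuot t j ≃ₗ[ℝ] sys.SymmetryQuot t j :=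
  quotEquivOfRangeEq rfl sys.kernel_submoduleOf_symmetries (sys.range_d_domRestrict_conserved ht)

theorem conservedQuotEquiv_conservedClass
    (ht : LinearMap.range (Forms.d (E := E) (M := M)) ≤ t.forms) {α : sys.conserved t j}
    {X : sys.symmetries t j} (h : sys.IsHamiltonianField α.1 X.1) :
    sys.conservedQuotEquiv ht j (sys.conservedClass t j α) = sys.symmetryClass t j X :=
  quotEquivOfRangeEq_mk _ _ _ h

variable [T2Space M]

/-- The Schouten bracket of symmetries. -/
def symmetryBracket (t : Kind) (i j : ℕ) :
    sys.symmetries t i →ₗ[ℝ] sys.symmetries t j →ₗ[ℝ] sys.symmetries t (i + j) :=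
  LinearMap.mk₂ ℝ (fun X Y => ⟨schouten i j X.1 Y.1, sys.schouten_mem_symmetries X.2 Y.2⟩)
    (fun X X' Y => Subtype.ext (by simp))
    (fun c X Y => Subtype.ext (by simp))
    (fun X Y Y' => Subtype.ext (by simp))
    (fun c X Y => Subtype.ext (by simp))

theorem isGradedLieBracket_symmetryBracket : IsGradedLieBracket (sys.symmetryBracket t) :=
  isGradedLieBracket_schouten.of_injective (fun j => (sys.symmetries t j).subtype)
    (fun _ => Subtype.val_injective) fun _ _ _ _ => rfl

theorem symmetryClass_symmetryBracket_eq_zero {X : sys.symmetries t i} {Y : sys.symmetries t j}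
    (h : contract Y.1 (contract X.1 sys.plecticForm) = 0) :
    sys.symmetryClass t (i + j) (sys.symmetryBracket t i j X Y) = 0 := by
  refine (Submodule.Quotient.mk_eq_zero _).2
    ((sys.contract_schouten_plecticForm X.2.1 Y.2.1).trans ?_)
  rw [h, map_zero, smul_zero]

/-- The Schouten bracket of classes of symmetries. -/
def symmetryQuotBracket (t : Kind) (i j : ℕ) :
    sys.SymmetryQuot t i →ₗ[ℝ] sys.SymmetryQuot t j →ₗ[ℝ] sys.SymmetryQuot t (i + j) :=
  LinearMap.liftQ₂ _ _ ((sys.symmetryBracket t i j).compr₂ (sys.symmetryClass t (i + j)))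
    (fun X hX => LinearMap.ext fun Y => sys.symmetryClass_symmetryBracket_eq_zero (by
      rw [show contract X.1 sys.plecticForm = 0 from hX, map_zero]))
    (fun Y hY => LinearMap.ext fun X => sys.symmetryClass_symmetryBracket_eq_zero (by
      rw [contract_contract, show contract Y.1 sys.plecticForm = 0 from hY, map_zero, smul_zero]))

theorem symmetryQuotBracket_symmetryClass (X : sys.symmetries t i) (Y : sys.symmetries t j) :
    sys.symmetryQuotBracket t i j (sys.symmetryClass t i X) (sys.symmetryClass t j Y) =
      sys.symmetryClass t (i + j) (sys.symmetryBracket t i j X Y) := rfl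

theorem isGradedLieBracket_symmetryQuotBracket : IsGradedLieBracket (sys.symmetryQuotBracket t) :=
  sys.isGradedLieBracket_symmetryBracket.of_surjective (sys.symmetryClass t)
    (fun _ => Submodule.mkQ_surjective _)
    fun _ _ X Y => (sys.symmetryQuotBracket_symmetryClass X Y).symm

/-- The Poisson bracket of classes of conserved quantities, transported from the Schouten bracket
of classes of symmetries; see `conservedQuotBracket_conservedClass`. -/
def conservedQuotBracket (ht : LinearMap.range (Forms.d (E := E) (M := M)) ≤ t.forms) (i j : ℕ) :
    sys.ConservedQuot t i →ₗ[ℝ] sys.ConservedQuot t j →ₗ[ℝ] sys.ConservedQuot t (i + j) :=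
  ((sys.symmetryQuotBracket t i j).compl₁₂ (sys.conservedQuotEquiv ht i).toLinearMap
    (sys.conservedQuotEquiv ht j).toLinearMap).compr₂ (sys.conservedQuotEquiv ht (i + j)).symm

theorem conservedQuotEquiv_conservedQuotBracket
    (ht : LinearMap.range (Forms.d (E := E) (M := M)) ≤ t.forms) (a : sys.ConservedQuot t i)
    (b : sys.ConservedQuot t j) :
    sys.conservedQuotEquiv ht (i + j) (sys.conservedQuotBracket ht i j a b) =
      sys.symmetryQuotBracket t i j (sys.conservedQuotEquiv ht i a)
        (sys.conservedQuotEquiv ht j b) :=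
  (sys.conservedQuotEquiv ht (i + j)).apply_symm_apply _

theorem isGradedLieBracket_conservedQuotBracket
    (ht : LinearMap.range (Forms.d (E := E) (M := M)) ≤ t.forms) :
    IsGradedLieBracket (sys.conservedQuotBracket ht) :=
  sys.isGradedLieBracket_symmetryQuotBracket.of_injective
    (fun j => (sys.conservedQuotEquiv ht j).toLinearMap)
    (fun j => (sys.conservedQuotEquiv ht j).injective)
    fun _ _ => sys.conservedQuotEquiv_conservedQuotBracket ht

theorem conservedQuotBracket_conservedClass
    (ht : LinearMap.range (Forms.d (E := E) (M := M)) ≤ t.forms) {α : sys.conserved t i}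
    {β : sys.conserved t j} {X : sys.symmetries t i} {Y : sys.symmetries t j}
    (hα : sys.IsHamiltonianField α.1 X.1) (hβ : sys.IsHamiltonianField β.1 Y.1) :
    sys.conservedQuotBracket ht i j (sys.conservedClass t i α) (sys.conservedClass t j β) =
      sys.conservedClass t (i + j) ⟨_, sys.poissonBracket_mem_conserved ht X.2 Y.2⟩ := by
  have hαβ : sys.IsHamiltonianField (sys.poissonBracket X.1 Y.1)
      (sys.symmetryBracket t i j X Y).1 :=
    sys.isHamiltonianField_poissonBracket X.2.1 Y.2.1
  apply (sys.conservedQuotEquiv ht (i + j)).injective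
  rw [conservedQuotEquiv_conservedQuotBracket, sys.conservedQuotEquiv_conservedClass ht hα,
    sys.conservedQuotEquiv_conservedClass ht hβ, symmetryQuotBracket_symmetryClass,
    sys.conservedQuotEquiv_conservedClass ht 
      (α := ⟨_, sys.poissonBracket_mem_conserved ht X.2 Y.2⟩) hαβ]

end MultiHamiltonianSystem

end Systems

end

end Multisymplectic

theorem mainTheorem10_general {E : Type*} [NormedAddCommGroup E] [NormedSpace ℝ E]
    [FiniteDimensional ℝ E] {M : Type*} [TopologicalSpace M] [T2Space M]
    [ChartedSpace E M] [IsManifold 𝓘(ℝ, E) ∞ M] {n : ℕ} (_hn : 1 ≤ n)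
    (sys : MultiHamiltonianSystem E M n) :
    ∃ br : ∀ i j : ℕ, MultiVec E M i →ₗ[ℝ] MultiVec E M j →ₗ[ℝ] MultiVec E M (i + j),
      IsSchoutenBracket br ∧
      IsGradedLieBracket (L := fun j => MultiVec E M j) br ∧
      (∀ (i j : ℕ) (X : MultiVec E M i) (Y : MultiVec E M j),
        X ∈ sys.hamiltonianFields i → Y ∈ sys.hamiltonianFields j →
          br i j X Y ∈ sys.hamiltonianFields (i + j)) ∧
      (∀ (t : Kind) (i j : ℕ) (X : MultiVec E M i) (Y : MultiVec E M j),
        X ∈ sys.symmetries t i → Y ∈ sys.symmetries t j →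
          br i j X Y ∈ sys.symmetries t (i + j)) ∧
      ∀ t : Kind, t = Kind.glob ∨ t = Kind.loc →
        ∃ (P : ∀ i j : ℕ, sys.ConservedQuot t i →ₗ[ℝ] sys.ConservedQuot t j →ₗ[ℝ]
            sys.ConservedQuot t (i + j))
          (B : ∀ i j : ℕ, sys.SymmetryQuot t i →ₗ[ℝ] sys.SymmetryQuot t j →ₗ[ℝ]
            sys.SymmetryQuot t (i + j))
          (Φ : ∀ j : ℕ, sys.ConservedQuot t j ≃ₗ[ℝ] sys.SymmetryQuot t j),
          IsGradedLieBracket P ∧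
          (∀ (i j : ℕ) (α : sys.conserved t i) (β : sys.conserved t j)
            (Xα : MultiVec E M i) (Xβ : MultiVec E M j),
            sys.IsHamiltonianField α.1 Xα → sys.IsHamiltonianField β.1 Xβ →
              ∃ h : sys.poissonBracket Xα Xβ ∈ sys.conserved t (i + j),
                P i j (sys.conservedClass t i α) (sys.conservedClass t j β) =
                  sys.conservedClass t (i + j) ⟨_, h⟩) ∧
          IsGradedLieBracket B ∧
          (∀ (i j : ℕ) (X : sys.symmetries t i) (Y : sys.symmetries t j),
            ∃ h : br i j X.1 Y.1 ∈ sys.symmetries t (i + j),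
              B i j (sys.symmetryClass t i X) (sys.symmetryClass t j Y) =
                sys.symmetryClass t (i + j) ⟨_, h⟩) ∧
          (∀ (j : ℕ) (α : sys.conserved t j) (X : MultiVec E M j),
            sys.IsHamiltonianField α.1 X →
              ∃ h : X ∈ sys.symmetries t j,
                Φ j (sys.conservedClass t j α) = sys.symmetryClass t j ⟨X, h⟩) ∧
          ∀ (i j : ℕ) (a : sys.ConservedQuot t i) (b : sys.ConservedQuot t j),
            Φ (i + j) (P i j a b) = B i j (Φ i a) (Φ j b) := by
  refine ⟨schouten, isSchoutenBracket_schouten, isGradedLieBracket_schouten,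
    fun _ _ _ _ => sys.schouten_mem_hamiltonianFields, fun _ _ _ _ _ => sys.schouten_mem_symmetries,
    fun t hglob_or_loc => ?_⟩
  have ht := Kind.range_d_le_forms (E := E) (M := M) hglob_or_loc
  refine ⟨sys.conservedQuotBracket ht, sys.symmetryQuotBracket t, sys.conservedQuotEquiv ht,
    sys.isGradedLieBracket_conservedQuotBracket ht, fun i j α β X Y hX hY => ?_,
    sys.isGradedLieBracket_symmetryQuotBracket,
    fun i j X Y => ⟨_, sys.symmetryQuotBracket_symmetryClass X Y⟩, fun j α X hX => ?_,
    fun i j => sys.conservedQuotEquiv_conservedQuotBracket ht⟩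
  · have hXsymm := sys.mem_symmetries_of_mem_conserved ht α.2 hX
    have hYsymm := sys.mem_symmetries_of_mem_conserved ht β.2 hY
    exact ⟨_, sys.conservedQuotBracket_conservedClass ht (X := ⟨X, hXsymm⟩) (Y := ⟨Y, hYsymm⟩)
      hX hY⟩
  · have hXsymm := sys.mem_symmetries_of_mem_conserved ht α.2 hX
    exact ⟨hXsymm, sys.conservedQuotEquiv_conservedClass ht (X := ⟨X, hXsymm⟩) hX⟩

theorem mainTheorem10 {E : Type*} [NormedAddCommGroup E] [NormedSpace ℝ E]
    [FiniteDimensional ℝ E] {M : Type*} [TopologicalSpace M] [T2Space M]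
    [SigmaCompactSpace M] [ChartedSpace E M] [IsManifold 𝓘(ℝ, E) ∞ M] {n : ℕ} (hn : 1 ≤ n)
    (sys : MultiHamiltonianSystem E M n) :
    ∃ br : ∀ i j : ℕ, MultiVec E M i →ₗ[ℝ] MultiVec E M j →ₗ[ℝ] MultiVec E M (i + j),
      IsSchoutenBracket br ∧
      IsGradedLieBracket (L := fun j => MultiVec E M j) br ∧
      (∀ (i j : ℕ) (X : MultiVec E M i) (Y : MultiVec E M j),
        X ∈ sys.hamiltonianFields i → Y ∈ sys.hamiltonianFields j →
          br i j X Y ∈ sys.hamiltonianFields (i + j)) ∧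
      (∀ (t : Kind) (i j : ℕ) (X : MultiVec E M i) (Y : MultiVec E M j),
        X ∈ sys.symmetries t i → Y ∈ sys.symmetries t j →
          br i j X Y ∈ sys.symmetries t (i + j)) ∧
      ∀ t : Kind, t = Kind.glob ∨ t = Kind.loc →
        ∃ (P : ∀ i j : ℕ, sys.ConservedQuot t i →ₗ[ℝ] sys.ConservedQuot t j →ₗ[ℝ]
            sys.ConservedQuot t (i + j))
          (B : ∀ i j : ℕ, sys.SymmetryQuot t i →ₗ[ℝ] sys.SymmetryQuot t j →ₗ[ℝ]
            sys.SymmetryQuot t (i + j))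
          (Φ : ∀ j : ℕ, sys.ConservedQuot t j ≃ₗ[ℝ] sys.SymmetryQuot t j),
          IsGradedLieBracket P ∧
          (∀ (i j : ℕ) (α : sys.conserved t i) (β : sys.conserved t j)
            (Xα : MultiVec E M i) (Xβ : MultiVec E M j),
            sys.IsHamiltonianField α.1 Xα → sys.IsHamiltonianField β.1 Xβ →
              ∃ h : sys.poissonBracket Xα Xβ ∈ sys.conserved t (i + j),
                P i j (sys.conservedClass t i α) (sys.conservedClass t j β) =
                  sys.conservedClass t (i + j) ⟨_, h⟩) ∧
          IsGradedLieBracket B ∧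
          (∀ (i j : ℕ) (X : sys.symmetries t i) (Y : sys.symmetries t j),
            ∃ h : br i j X.1 Y.1 ∈ sys.symmetries t (i + j),
              B i j (sys.symmetryClass t i X) (sys.symmetryClass t j Y) =
                sys.symmetryClass t (i + j) ⟨_, h⟩) ∧
          (∀ (j : ℕ) (α : sys.conserved t j) (X : MultiVec E M j),
            sys.IsHamiltonianField α.1 X →
              ∃ h : X ∈ sys.symmetries t j,
                Φ j (sys.conservedClass t j α) = sys.symmetryClass t j ⟨X, h⟩) ∧
          ∀ (i j : ℕ) (a : sys.ConservedQuot t i) (b : sys.ConservedQuot t j),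
            Φ (i + j) (P i j a b) = B i j (Φ i a) (Φ j b) :=
  mainTheorem10_general hn sys
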